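/- Let $s\in\{\tfrac12,1,\tfrac32,\dots\}$ and let $n$ be an integer with $0\le n\le 3s$. Let $I$ be the set of integers $k$ with $0\le k\le n$ if $n\le 2s$, and with $n-2s\le k\le 4s-n$ if $2s\le n\le 3s$. Consider the real matrices with rows and columns indexed by $I$ $$A_{kk'}=A^{(s,n)}_{kk'}=(-1)^{2s-n}\sqrt{(4s-2k+1)(4s-2k'+1)}\,\begin{Bmatrix} s&s&2s-k\\ s&3s-n&2s-k'\end{Bmatrix},\qquad (D_0^{(n)})_{kk'}=(-1)^k\delta_{kk'},$$ where the braces denote the Wigner $6$-$j$ symbol of $sl_2$, and, for $m\in I$, $(\pi^{(m,n)})_{kk'}=\delta_{km}\delta_{k'm}$. Put $\hat D_0^{(n)}=A D_0^{(n)}A$, $\hat\pi^{(m,n)}=A\pi^{(m,n)}A$, $\xi_m=(-1)^m$ and $\eta_{m,n}=(-1)^nA^{(s,n)}_{mm}$. Then for every $m\in I$ the relations $$Q^2=Q,\qquad S^2=1,\qquad QS=SQ=\xi Q,$$ $$SS'S=S'SS',$$ $$QS'S=S'SQ',\qquad SQ'S=S'QS',$$ $$QS'Q=\eta Q,\qquad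 QQ'Q=\eta^2Q,$$ $$QQ'S=\xi\eta\,QS',\qquad SQ'Q=\xi\eta\,S'Q$$ hold with $\xi=\xi_m$ and $\eta=\eta_{m,n}$, both for $(S,S',Q,Q')=(D_0^{(n)},\hat D_0^{(n)},\pi^{(m,n)},\hat\pi^{(m,n)})$ and for $(S,S',Q,Q')=(\hat D_0^{(n)},D_0^{(n)},\hat\pi^{(m,n)},\pi^{(m,n)})$. -/

import Mathlib

noncomputable section

/-- The triangle condition for three spins `a/2`, `b/2`, `c/2`, given by their doubles:
`a/2 + b/2 + c/2` is an integer and each spin is at most the sum of the other two. -/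
def SpinTriad (a b c : ℕ) : Prop :=
  Even (a + b + c) ∧ a ≤ b + c ∧ b ≤ a + c ∧ c ≤ a + b

/-- The triangle coefficient `Δ(a/2, b/2, c/2)`; it is used only under `SpinTriad a b c`, when
all the divisions and subtractions are exact. -/
def triangleCoeff (a b c : ℕ) : ℝ :=
  Real.sqrt
    (((((a + b - c) / 2).factorial : ℝ) * (((a + c - b) / 2).factorial : ℝ) *
        (((b + c - a) / 2).factorial : ℝ)) /
      (((a + b + c) / 2 + 1).factorial : ℝ))

/-- The alternating sum in Racah's formula for the 6-j symbol. The index `t` runs over all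
integers for which the arguments of all the factorials are nonnegative. -/
def racahSum (a b c d e f : ℕ) : ℝ :=
  ∑ t ∈ Finset.Icc
      (max (max ((a + b + c) / 2) ((a + e + f) / 2)) (max ((d + b + f) / 2) ((d + e + c) / 2)))
      (min (min ((a + b + d + e) / 2) ((b + c + e + f) / 2)) ((a + c + d + f) / 2)),
    (-1 : ℝ) ^ t * ((t + 1).factorial : ℝ) /
      (((t - (a + b + c) / 2).factorial : ℝ) * ((t - (a + e + f) / 2).factorial : ℝ) *
        ((t - (d + b + f) / 2).factorial : ℝ) * ((t - (d + e + c) / 2).factorial : ℝ) *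
        (((a + b + d + e) / 2 - t).factorial : ℝ) * (((b + c + e + f) / 2 - t).factorial : ℝ) *
        (((a + c + d + f) / 2 - t).factorial : ℝ))

open Classical in
/-- The 6-j symbol `{a/2 b/2 c/2; d/2 e/2 f/2}` of `sl₂` (upper row `a/2 b/2 c/2`, lower row
`d/2 e/2 f/2`; the arguments are doubled spins), by Racah's formula. It is zero unless the four
triads satisfy the triangle condition. -/
def sixJ (a b c d e f : ℕ) : ℝ :=
  if SpinTriad a b c ∧ SpinTriad a e f ∧ SpinTriad d b f ∧ SpinTriad d e c then
    triangleCoeff a b c * triangleCoeff a e f * triangleCoeff d b f * triangleCoeff d e c *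
      racahSum a b c d e f
  else 0

/-- With `N = 2s`: the range of `k`, namely `0 ≤ k ≤ n` if `n ≤ 2s`, and
`n - 2s ≤ k ≤ 4s - n` if `2s ≤ n ≤ 3s` (the two agree for `n = 2s`). -/
def levelRange (N n : ℕ) : Finset ℕ :=
  if n ≤ N then Finset.Icc 0 n else Finset.Icc (n - N) (2 * N - n)

/-- With `N = 2s`: the matrix `A^{(s,n)}`,
`A_{kk'} = (-1)^{2s-n} √((4s-2k+1)(4s-2k'+1)) {s s 2s-k; s 3s-n 2s-k'}`. -/
def matA (N n : ℕ) : Matrix (levelRange N n) (levelRange N n) ℝ :=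
  Matrix.of fun k k' =>
    (-1 : ℝ) ^ ((N : ℤ) - (n : ℤ)) *
      Real.sqrt ((2 * (N : ℝ) - 2 * ((k : ℕ) : ℝ) + 1) * (2 * (N : ℝ) - 2 * ((k' : ℕ) : ℝ) + 1)) *
      sixJ N N (2 * N - 2 * (k : ℕ)) N (3 * N - 2 * n) (2 * N - 2 * (k' : ℕ))

/-- The diagonal matrix `D_0^{(n)}` with entries `(-1)^k δ_{kk'}`. -/
def matD (N n : ℕ) : Matrix (levelRange N n) (levelRange N n) ℝ :=
  Matrix.diagonal fun k => (-1 : ℝ) ^ (k : ℕ)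

/-- The matrix `D̂_0^{(n)} = A D_0 A`. -/
def matDhat (N n : ℕ) : Matrix (levelRange N n) (levelRange N n) ℝ :=
  matA N n * matD N n * matA N n

/-- The matrix unit `π^{(m,n)}`, with entries `δ_{km} δ_{k'm}`. -/
def matPi (N n : ℕ) (m : levelRange N n) : Matrix (levelRange N n) (levelRange N n) ℝ :=
  Matrix.of fun k k' => if k = m ∧ k' = m then 1 else 0

/-- The matrix `π̂^{(m,n)} = A π^{(m,n)} A`. -/
def matPihat (N n : ℕ) (m : levelRange N n) : Matrix (levelRange N n) (levelRange N n) ℝ :=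
  matA N n * matPi N n m * matA N n

/-- The relations between the permutations `S = ℙ_l`, `S' = ℙ_{l'}` and the projectors
`Q = P⁰_l`, `Q' = P⁰_{l'}`, with scalar constants `ξ` and `η`, for one ordered pair `(l, l')`. -/
structure PermProjRelations {M : Type*} [Ring M] [Algebra ℝ M] (S S' Q Q' : M) (ξ η : ℝ) :
    Prop where
  proj_sq : Q * Q = Q
  perm_sq : S * S = 1
  proj_perm : Q * S = ξ • Q
  perm_proj : S * Q = ξ • Q
  braid : S * S' * S = S' * S * S'
  proj_perm_perm : Q * S' * S = S' * S * Q'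
  perm_proj_perm : S * Q' * S = S' * Q * S'
  proj_perm_proj : Q * S' * Q = η • Q
  proj_proj_proj : Q * Q' * Q = (η ^ 2) • Q
  proj_proj_perm : Q * Q' * S = (ξ * η) • (Q * S')
  perm_proj_proj : S * Q' * Q = (ξ * η) • (S' * Q)

end

/-! Everything follows formally from three facts, with D = `matD`: A² = 1, D² = 1 and ADA = (-1)^n
DAD, together with `π` being a rank-one projector on an eigenvector of D
(`PermProjRelations.of_involutions`). The second family of relations is the image of the first under
conjugation by A, which swaps hatted and unhatted matrices.

The facts about A express the recoupling of three equal spins. Up to diagonal factors A is a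
symmetric matrix R of Racah polynomials, whose three-term recurrence reads UR = RL, with U
tridiagonal and L diagonal: two of the three pairwise Casimir operators. Since the spins are equal,
the diagonal of U is (c - L)/2, where c is the sum of the three Casimirs, so conjugating U by the
signs gives c - L - U, the third one. With H the weight that symmetrises U, and D now the matrix of
signs, RDHR and DRD satisfy the same two intertwining relations. These determine a matrix up to a
scalar, which one corner entry fixes; this is `racahMat_braid_aux`.

In the same way RHR is a multiple of H⁻¹, so A² = g. Squaring the braid relation gives g² = g, and A
is real symmetric and nonzero, whence g = 1 (`racahOrtho_mul_self`). Thus orthogonality needs no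
separate summation. -/

noncomputable section

/-! ### Inverse factorials on the integers -/

/-- The inverse factorial `1 / z!`, extended by zero to the negative integers. -/
def invFact (z : ℤ) : ℝ := if 0 ≤ z then ((z.toNat.factorial : ℕ) : ℝ)⁻¹ else 0

theorem invFact_natCast (n : ℕ) : invFact n = ((n.factorial : ℕ) : ℝ)⁻¹ := by
  simp [invFact]

theorem invFact_of_neg {z : ℤ} (hz : z < 0) : invFact z = 0 := by
  simp [invFact, not_le.2 hz]

theorem invFact_of_eq {z : ℤ} {n : ℕ} (h : z = n) :
    invFact z = ((n.factorial : ℕ) : ℝ)⁻¹ := by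
  rw [h, invFact_natCast]

theorem invFact_eq_mul_add_one (z : ℤ) : invFact z = ((z : ℝ) + 1) * invFact (z + 1) := by
  rcases lt_trichotomy z (-1) with h | h | h
  · rw [invFact_of_neg (by omega), invFact_of_neg (by omega), mul_zero]
  · subst h
    rw [invFact_of_neg (by omega)]
    push_cast
    ring
  · obtain ⟨n, rfl⟩ := Int.eq_ofNat_of_zero_le (by omega : 0 ≤ z)
    rw [invFact_natCast, invFact_of_eq (n := n + 1) (by push_cast; ring), Nat.factorial_succ]
    have := Nat.factorial_pos n
    push_cast
    field_simp

theorem invFact_eq_mul {z y : ℤ} (h : y = z + 1) {x : ℝ} (hx : (y : ℝ) = x) :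
    invFact z = x * invFact y := by
  subst h hx
  rw [invFact_eq_mul_add_one z]
  push_cast
  rfl

/-- The two inverse factorials are both nonzero only for z = -1 and z = 0, the zeros of the
polynomial factor. -/
theorem mul_invFact_mul_invFact (z : ℤ) :
    (z : ℝ) * ((z : ℝ) + 1) * invFact (-z) * invFact (z + 1) = 0 := by
  rcases lt_trichotomy z 0 with h | h | h
  · rcases eq_or_ne z (-1) with rfl | h'
    · simp
    · rw [invFact_of_neg (by omega : z + 1 < 0), mul_zero]
  · simp [h]
  · rw [invFact_of_neg (by omega : -z < 0)]
    ring

/-! ### Racah polynomials and their three-term recurrence -/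

/-- The summand of the Racah polynomial `racahPoly`. -/
def racahTerm (d r : ℕ) (p q : ℤ) (i : ℕ) : ℝ :=
  (-1) ^ i * ((2 * d + 3 * r + 1 - i).factorial : ℝ) *
    (invFact (p - i) * invFact (q - i) * invFact (r + p - i) * invFact (r + q - i) * invFact i *
      invFact (d - p - q + i) * invFact (d + r - p - q + i))

/-- The `6`-`j` symbols of three equal spins, up to normalisation, in coordinates in which the
range of both indices is `0, …, d`. -/
def racahPoly (d r : ℕ) (p q : ℤ) : ℝ := ∑ i ∈ Finset.range (d + 1), racahTerm d r p q i

theorem racahPoly_comm (d r : ℕ) (p q : ℤ) : racahPoly d r p q = racahPoly d r q p := by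
  refine Finset.sum_congr rfl fun i _ => ?_
  unfold racahTerm
  rw [show (d : ℤ) - p - q + i = d - q - p + i by ring,
    show (d : ℤ) + r - p - q + i = d + r - q - p + i by ring]
  ring

theorem racahPoly_neg {d r : ℕ} {p q : ℤ} (hp : p < 0) : racahPoly d r p q = 0 := by
  refine Finset.sum_eq_zero fun i _ => ?_
  rw [racahTerm, invFact_of_neg (by omega : p - i < 0)]
  simp

theorem racahPoly_of_lt {d r : ℕ} {p q : ℤ} (hp : d < p) : racahPoly d r p q = 0 := by
  refine Finset.sum_eq_zero fun i _ => ?_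
  rcases lt_or_ge q i with h | h
  · rw [racahTerm, invFact_of_neg (by omega : q - i < 0)]
    simp
  · rw [racahTerm, invFact_of_neg (by omega : d - p - q + i < 0)]
    simp

/-- The Casimir eigenvalue `j (j + 1)`, `j = d + r - x`. -/
def casimir (d r : ℕ) (x : ℝ) : ℝ := (d + r - x) * (d + r - x + 1)

/-- The sum of the three pairwise Casimir operators. -/
def casimirSum (d r : ℕ) : ℝ :=
  (3 * (d + r) * (d + r + 2) + (d + 3 * r) * (d + 3 * r + 2)) / 4

/-- The certificate of creative telescoping for the recurrence of `racahTerm` in `p`. -/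
def racahCert (d r p q i : ℝ) : ℝ :=
  -(r + 1 + p) * (2 * (d + r) + 1 - p) * (d - q + 1) * (d - q + 1 + r) -
    (d - q + 1 + r) * (2 * (p + 1) * (2 * (d + r) + 1 - p) + (p + 1) * (d - q + 1) +
      2 * r * (p + 1) - (2 * (d + r) + 1 - p) * (d - q + 1)) * (i - p - 1) +
    (-(d + r - p) * (d + 2 * r + 1 - p) - (p + 1) * (2 * (d + r) + 1 - p) - 2 * r * (p + 1) +
      r * (2 * (d + r) + 1 - p) + (d - q + 1) * (2 * (d + r) - 2 * p)) *
      (i - p - 1) * (i - p - 1 - r)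

/-- The antidifference belonging to `racahCert`. -/
def racahAnti (d r : ℕ) (p q : ℤ) (i : ℕ) : ℝ :=
  (-1) ^ i * ((2 * d + 3 * r + 2 - i).factorial : ℝ) *
    (invFact (p + 1 - i) * invFact (q - i) * invFact (r + p + 1 - i) * invFact (r + q - i) *
      invFact (i - 1) * invFact (d - p - q + i) * invFact (d + r - p - q + i)) *
    racahCert d r p q i

/-- Creative telescoping. The rule 1/z! = (z+1)/(z+1)! holds at every integer, so a common product
of inverse factorials can be pulled out without boundary cases, leaving the polynomial identity
`key`. -/
theorem racahTerm_recurrence (d r : ℕ) (p q : ℤ) (i : ℕ) (hi : i ≤ d) :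
    (p + 1) * (r + 1 + p) * (2 * (d + r) + 1 - p) * (2 * d + 3 * r + 1 - p) *
        racahTerm d r (p + 1) q i +
      2 * (d + r - p) * (2 * (d + r - p) + 1) *
        ((casimirSum d r - casimir d r p) / 2 - casimir d r q) * racahTerm d r p q i +
      (d + r - p) * (d + r - p + 1) * (d - p + 1) * (d + 2 * r - p + 1) *
        racahTerm d r (p - 1) q i =
    racahAnti d r p q (i + 1) - racahAnti d r p q i := by
  have hf : ((2 * d + 3 * r + 2 - i).factorial : ℝ) =
      (2 * d + 3 * r + 2 - i) * ((2 * d + 3 * r + 1 - i).factorial : ℝ) := by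
    rw [show 2 * d + 3 * r + 2 - i = (2 * d + 3 * r + 1 - i) + 1 by omega, Nat.factorial_succ]
    push_cast [Nat.cast_sub (by omega : i ≤ 2 * d + 3 * r + 1)]
    ring
  have hf' : 2 * d + 3 * r + 2 - (i + 1) = 2 * d + 3 * r + 1 - i := by omega
  simp only [racahTerm, racahAnti, hf, hf', pow_succ]
  push_cast
  have e1 : invFact (p - i) = (p + 1 - i) * invFact (p + 1 - i) :=
    invFact_eq_mul (by ring) (by push_cast; ring)
  have e2 : invFact (p - 1 - i) = (p - i) * ((p + 1 - i) * invFact (p + 1 - i)) := by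
    rw [← e1]; exact invFact_eq_mul (by ring) (by push_cast; ring)
  have e3 : invFact (r + p - i) = (r + p + 1 - i) * invFact (r + p + 1 - i) :=
    invFact_eq_mul (by ring) (by push_cast; ring)
  have e4 : invFact (r + (p - 1) - i) =
      (r + p - i) * ((r + p + 1 - i) * invFact (r + p + 1 - i)) := by
    rw [← e3]; exact invFact_eq_mul (by ring) (by push_cast; ring)
  have e5 : invFact (d - p - q + i) = (d - p - q + i + 1) * invFact (d - p - q + i + 1) :=
    invFact_eq_mul (by ring) (by push_cast; ring)
  have e6 : invFact (d - (p + 1) - q + i) =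
      (d - p - q + i) * ((d - p - q + i + 1) * invFact (d - p - q + i + 1)) := by
    rw [← e5]; exact invFact_eq_mul (by ring) (by push_cast; ring)
  have e7 : invFact (d + r - p - q + i) =
      (d + r - p - q + i + 1) * invFact (d + r - p - q + i + 1) :=
    invFact_eq_mul (by ring) (by push_cast; ring)
  have e8 : invFact (d + r - (p + 1) - q + i) =
      (d + r - p - q + i) * ((d + r - p - q + i + 1) * invFact (d + r - p - q + i + 1)) := by
    rw [← e7]; exact invFact_eq_mul (by ring) (by push_cast; ring)
  have e9 : invFact ((i : ℤ) - 1) = i * invFact i :=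
    invFact_eq_mul (by ring) (by push_cast; ring)
  have e10 : invFact (q - (i + 1)) = (q - i) * invFact (q - i) :=
    invFact_eq_mul (by ring) (by push_cast; ring)
  have e11 : invFact (r + q - (i + 1)) = (r + q - i) * invFact (r + q - i) :=
    invFact_eq_mul (by ring) (by push_cast; ring)
  rw [show (r : ℤ) + (p + 1) - i = r + p + 1 - i by ring,
    show p + 1 - ((i : ℤ) + 1) = p - i by ring,
    show (r : ℤ) + p + 1 - (i + 1) = r + p - i by ring,
    show (i : ℤ) + 1 - 1 = i by ring,
    show (d : ℤ) - p - q + (i + 1) = d - p - q + i + 1 by ring,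
    show (d : ℤ) + r - p - q + (i + 1) = d + r - p - q + i + 1 by ring,
    show (d : ℤ) - (p - 1) - q + i = d - p - q + i + 1 by ring,
    show (d : ℤ) + r - (p - 1) - q + i = d + r - p - q + i + 1 by ring,
    e6, e8, e2, e4, e9, e10, e11, e1, e3, e5, e7]
  generalize invFact (p + 1 - i) = x1
  generalize invFact (r + p + 1 - i) = x2
  generalize invFact (q - i) = x3
  generalize invFact (r + q - i) = x4
  generalize invFact (d - p - q + i + 1) = x5
  generalize invFact (d + r - p - q + i + 1) = x6
  generalize invFact i = x7
  generalize ((2 * d + 3 * r + 1 - i).factorial : ℝ) = F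
  generalize (-1 : ℝ) ^ i = s
  have key : ∀ d r p q i : ℝ,
      (p + 1) * (r + 1 + p) * (2 * (d + r) + 1 - p) * (2 * d + 3 * r + 1 - p) *
        ((d - p - q + i) * (d - p - q + i + 1) * ((d + r - p - q + i) * (d + r - p - q + i + 1))) +
      2 * (d + r - p) * (2 * (d + r - p) + 1) *
        (((3 * (d + r) * (d + r + 2) + (d + 3 * r) * (d + 3 * r + 2)) / 4 -
          (d + r - p) * (d + r - p + 1)) / 2 - (d + r - q) * (d + r - q + 1)) *
        ((p + 1 - i) * (r + p + 1 - i) * (d - p - q + i + 1) * (d + r - p - q + i + 1)) +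
      (d + r - p) * (d + r - p + 1) * (d - p + 1) * (d + 2 * r - p + 1) *
        ((p - i) * (p + 1 - i) * ((r + p - i) * (r + p + 1 - i))) =
      -((p + 1 - i) * (q - i) * (r + p + 1 - i) * (r + q - i) * racahCert d r p q (i + 1)) -
        (2 * d + 3 * r + 2 - i) * i * (d - p - q + i + 1) * (d + r - p - q + i + 1) *
          racahCert d r p q i := by
    intro d r p q i
    -- The variables u = p + 1, j = d + r - p, w = d - q + 1 and z = i - p - 1 are those in which
    -- the certificate is short.
    obtain ⟨u, rfl⟩ : ∃ u, p = u - 1 := ⟨p + 1, by ring⟩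
    obtain ⟨j, rfl⟩ : ∃ j, d = j + u - 1 - r := ⟨d + r - u + 1, by ring⟩
    obtain ⟨w, rfl⟩ : ∃ w, q = j + u - r - w := ⟨j + u - r - q, by ring⟩
    obtain ⟨z, rfl⟩ : ∃ z, i = z + u := ⟨i - u, by ring⟩
    unfold racahCert
    ring
  have key := key d r p q i
  unfold casimir casimirSum
  generalize ((p : ℝ) + 1) * (r + 1 + p) * (2 * (d + r) + 1 - p) * (2 * d + 3 * r + 1 - p) = c1
    at key ⊢
  generalize 2 * ((d : ℝ) + r - p) * (2 * (d + r - p) + 1) *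
    (((3 * (d + r) * (d + r + 2) + (d + 3 * r) * (d + 3 * r + 2)) / 4 -
      (d + r - p) * (d + r - p + 1)) / 2 - (d + r - q) * (d + r - q + 1)) = c2 at key ⊢
  generalize ((d : ℝ) + r - p) * (d + r - p + 1) * (d - p + 1) * (d + 2 * r - p + 1) = c3
    at key ⊢
  generalize racahCert d r p q (i + 1) = g1 at key ⊢
  generalize racahCert d r p q i = g0 at key ⊢
  generalize (p : ℝ) + 1 - i = a1 at key ⊢
  generalize (p : ℝ) - i = a2 at key ⊢
  generalize (r : ℝ) + p + 1 - i = a3 at key ⊢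
  generalize (r : ℝ) + p - i = a4 at key ⊢
  generalize (q : ℝ) - i = a5 at key ⊢
  generalize (r : ℝ) + q - i = a6 at key ⊢
  generalize (d : ℝ) - p - q + i = a7 at key ⊢
  generalize (d : ℝ) + r - p - q + i = a8 at key ⊢
  generalize 2 * (d : ℝ) + 3 * r + 2 - i = a9 at key ⊢
  linear_combination (s * F * x1 * x2 * x3 * x4 * x5 * x6 * x7) * key

theorem racahPoly_recurrence_mul (d r : ℕ) (p q : ℤ) (hq : q ≤ d) :
    (p + 1) * (r + 1 + p) * (2 * (d + r) + 1 - p) * (2 * d + 3 * r + 1 - p) *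
        racahPoly d r (p + 1) q +
      2 * (d + r - p) * (2 * (d + r - p) + 1) *
        ((casimirSum d r - casimir d r p) / 2 - casimir d r q) * racahPoly d r p q +
      (d + r - p) * (d + r - p + 1) * (d - p + 1) * (d + 2 * r - p + 1) *
        racahPoly d r (p - 1) q = 0 := by
  simp only [racahPoly, Finset.mul_sum, ← Finset.sum_add_distrib]
  rw [Finset.sum_congr rfl fun i hi => racahTerm_recurrence d r p q i
    (by simpa [Nat.lt_succ_iff] using hi), Finset.sum_range_sub]
  have h0 : racahAnti d r p q 0 = 0 := by
    simp [racahAnti, invFact_of_neg (by omega : (-1 : ℤ) < 0)]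
  have h1 : racahAnti d r p q (d + 1) = 0 := by
    rw [racahAnti, invFact_of_neg (by push_cast; omega : q - ((d + 1 : ℕ) : ℤ) < 0)]
    simp
  rw [h0, h1, sub_zero]

/-- For p = d and r = 0 the intermediate spin d + r - p is zero and `racahPoly_recurrence_mul`
degenerates to 0 = 0. This case needs its own antidifference. -/
theorem racahPoly_recurrence_last (d : ℕ) (q : ℤ) (hq : q ≤ d) :
    2 * ((casimirSum d 0 - casimir d 0 d) / 2 - casimir d 0 q) * racahPoly d 0 d q +
      racahPoly d 0 (d - 1) q = 0 := by
  let G : ℕ → ℝ := fun i => -((-1) ^ i * ((2 * d + 2 - i).factorial : ℝ) *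
    (invFact (d - i) ^ 2 * invFact (q - i) ^ 2 * invFact (i - 1) * invFact (i - q) ^ 2))
  have hG : ∀ i ∈ Finset.range (d + 1),
      2 * ((casimirSum d 0 - casimir d 0 d) / 2 - casimir d 0 q) * racahTerm d 0 d q i +
      racahTerm d 0 (d - 1) q i = G (i + 1) - G i := by
    intro i hi
    have hi : i ≤ d := by simpa [Nat.lt_succ_iff] using hi
    have hf : ((2 * d + 2 - i).factorial : ℝ) =
        (2 * d + 2 - i) * ((2 * d + 1 - i).factorial : ℝ) := by
      rw [show 2 * d + 2 - i = (2 * d + 1 - i) + 1 by omega, Nat.factorial_succ]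
      push_cast [Nat.cast_sub (by omega : i ≤ 2 * d + 1)]
      ring
    have hf' : 2 * d + 2 - (i + 1) = 2 * d + 1 - i := by omega
    simp only [G, racahTerm, hf, hf', pow_succ, mul_zero, add_zero]
    push_cast
    have e1 : invFact ((d : ℤ) - 1 - i) = (d - i) * invFact (d - i) :=
      invFact_eq_mul (by ring) (by push_cast; ring)
    have e2 : invFact ((d : ℤ) - (i + 1)) = (d - i) * invFact (d - i) :=
      invFact_eq_mul (by ring) (by push_cast; ring)
    have e3 : invFact (q - (i + 1)) = (q - i) * invFact (q - i) :=
      invFact_eq_mul (by ring) (by push_cast; ring)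
    have e4 : invFact ((i : ℤ) - 1) = i * invFact i :=
      invFact_eq_mul (by ring) (by push_cast; ring)
    have e5 : invFact ((i : ℤ) - q) = (i - q + 1) * invFact (i - q + 1) :=
      invFact_eq_mul (by ring) (by push_cast; ring)
    have h0 := mul_invFact_mul_invFact (i - q)
    push_cast at h0
    rw [neg_sub] at h0
    simp only [zero_add, add_zero, sub_self, zero_sub, add_sub_cancel_right,
      show (i : ℤ) + 1 - q = i - q + 1 by ring,
      show (d : ℤ) - (d - 1) - q + i = i - q + 1 by ring,
      show -q + (i : ℤ) = i - q by ring]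
    rw [e1, e2, e3, e4, e5]
    generalize invFact (d - i) = x1 at *
    generalize invFact (q - i) = x2 at *
    generalize invFact (i - q + 1) = x3 at *
    generalize invFact i = x4 at *
    generalize ((2 * d + 1 - i).factorial : ℝ) = F
    generalize (-1 : ℝ) ^ i = s
    unfold casimirSum casimir
    push_cast
    -- The two sides differ as polynomials, but only by a multiple of z(z+1) with z = i - q, which
    -- the factors 1/(q-i)! and 1/(i-q+1)! annihilate.
    linear_combination (s * F * x1 ^ 2 * x2 * x3 * x4 *
      (2 * (((3 * d * (d + 2) + d * (d + 2)) / 4) / 2 - (d - q) * (d - q + 1))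
        - i * (2 * d + 2 - i) - (d - i) ^ 2 + 2 * (i + q) - 4 * d - 2)) * h0
  simp only [racahPoly, Finset.mul_sum, ← Finset.sum_add_distrib]
  rw [Finset.sum_congr rfl hG, Finset.sum_range_sub]
  have h0 : G 0 = 0 := by
    simp [G, invFact_of_neg (by omega : (-1 : ℤ) < 0)]
  have h1 : G (d + 1) = 0 := by
    simp only [G]
    rw [invFact_of_neg (by push_cast; omega : q - ((d + 1 : ℕ) : ℤ) < 0)]
    simp
  rw [h0, h1, sub_zero]

/-- The coefficient of `racahPoly d r (p + 1) q` in the three-term recurrence. -/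
def upCoeff (d r : ℕ) (x : ℝ) : ℝ :=
  (x + 1) * (r + 1 + x) * (2 * (d + r) + 1 - x) * (2 * d + 3 * r + 1 - x) /
    (2 * (d + r - x) * (2 * (d + r - x) + 1))

/-- The coefficient of `racahPoly d r (p - 1) q` in the three-term recurrence. -/
def downCoeff (d r : ℕ) (x : ℝ) : ℝ :=
  (d - x + 1) * (d + 2 * r - x + 1) * (d + r - x + 1) / (2 * (2 * (d + r - x) + 1))

theorem upCoeff_pos {d r p : ℕ} (hp : p < d) : 0 < upCoeff d r p := by
  have : (p : ℝ) + 1 ≤ d := by exact_mod_cast hp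
  have hr : (0 : ℝ) ≤ r := by positivity
  have hp0 : (0 : ℝ) ≤ p := by positivity
  have h1 : (0 : ℝ) < 2 * (d + r) + 1 - p := by linarith
  have h2 : (0 : ℝ) < 2 * d + 3 * r + 1 - p := by linarith
  have h3 : (0 : ℝ) < d + r - p := by linarith
  unfold upCoeff
  positivity

theorem downCoeff_pos {d r p : ℕ} (hp : p ≤ d) : 0 < downCoeff d r p := by
  have : (p : ℝ) ≤ d := by exact_mod_cast hp
  have hr : (0 : ℝ) ≤ r := by positivity
  have h1 : (0 : ℝ) < d - p + 1 := by linarith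
  have h2 : (0 : ℝ) < d + 2 * r - p + 1 := by linarith
  have h3 : (0 : ℝ) < d + r - p + 1 := by linarith
  have h4 : (0 : ℝ) < 2 * (d + r - p) + 1 := by linarith
  unfold downCoeff
  positivity

/-- The three-term recurrence for `racahPoly`. -/
theorem racahPoly_recurrence {d r p : ℕ} {q : ℤ} (hp : p ≤ d) (hq : q ≤ d) :
    upCoeff d r p * racahPoly d r (p + 1) q +
      (casimirSum d r - casimir d r p) / 2 * racahPoly d r p q +
      downCoeff d r p * racahPoly d r (p - 1) q = casimir d r q * racahPoly d r p q := by
  have hp' : (p : ℝ) ≤ d := by exact_mod_cast hp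
  by_cases hX : p = d ∧ r = 0
  · obtain ⟨rfl, rfl⟩ := hX
    have h := racahPoly_recurrence_last p q hq
    -- Here the denominator of `upCoeff` is zero; its value is irrelevant because the polynomial it
    -- multiplies vanishes.
    rw [racahPoly_of_lt (by omega : (p : ℤ) < p + 1)]
    have : downCoeff p 0 p = 1 / 2 := by norm_num [downCoeff]
    rw [this]
    linear_combination h / 2
  · have hj : (0 : ℝ) < d + r - p := by
      have : p < d + r := by omega
      have : (p : ℝ) < d + r := by exact_mod_cast this
      linarith
    have h := racahPoly_recurrence_mul d r p q hq
    unfold upCoeff downCoeff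
    push_cast at h
    have h1 : (2 * ((d : ℝ) + r - p) + 1) ≠ 0 := by linarith
    have h2 : ((d : ℝ) + r - p) ≠ 0 := hj.ne'
    generalize casimir d r p = cp at *
    generalize casimir d r q = cq at *
    generalize casimirSum d r = c at *
    generalize racahPoly d r (p + 1) q = R1 at *
    generalize racahPoly d r (p - 1) q = R2 at *
    generalize racahPoly d r p q = R0 at *
    generalize hjj : (d : ℝ) + r - p = j at *
    field_simp
    linear_combination h

/-! ### The weight and detailed balance -/

/-- The weight of the orthogonality relation for `racahPoly`. -/
def racahWeight (d r p : ℕ) : ℝ :=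
  (2 * (d + r - p) + 1) *
    (p.factorial * (r + p).factorial * (d - p).factorial * ((d + r - p).factorial : ℝ) ^ 2 *
      (d + 2 * r - p).factorial) /
    ((2 * (d + r) + 1 - p).factorial * (2 * d + 3 * r + 1 - p).factorial)

theorem racahWeight_pos {d r p : ℕ} (hp : p ≤ d) : 0 < racahWeight d r p := by
  have : (p : ℝ) ≤ d := by exact_mod_cast hp
  have hr : (0 : ℝ) ≤ r := by positivity
  have h4 : (0 : ℝ) < 2 * (d + r - p) + 1 := by linarith
  have := fun n => Nat.factorial_pos n
  unfold racahWeight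
  positivity

/-- Detailed balance: it is what makes the weight symmetrise the tridiagonal matrix in
`weightMat_mul_jacobiMat`. -/
theorem racahWeight_balance {d r p : ℕ} (hp : p < d) :
    racahWeight d r p * upCoeff d r p = downCoeff d r (p + 1) * racahWeight d r (p + 1) := by
  obtain ⟨e, rfl⟩ : ∃ e, d = p + 1 + e := ⟨d - (p + 1), by omega⟩
  unfold racahWeight upCoeff downCoeff
  rw [show p + 1 + e - p = e + 1 by omega, show p + 1 + e + r - p = e + r + 1 by omega,
    show p + 1 + e + 2 * r - p = e + 2 * r + 1 by omega,
    show 2 * (p + 1 + e + r) + 1 - p = (p + 2 * e + 2 * r + 2) + 1 by omega,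
    show 2 * (p + 1 + e) + 3 * r + 1 - p = (p + 2 * e + 3 * r + 2) + 1 by omega,
    show p + 1 + e - (p + 1) = e by omega, show p + 1 + e + r - (p + 1) = e + r by omega,
    show p + 1 + e + 2 * r - (p + 1) = e + 2 * r by omega,
    show 2 * (p + 1 + e + r) + 1 - (p + 1) = p + 2 * e + 2 * r + 2 by omega,
    show 2 * (p + 1 + e) + 3 * r + 1 - (p + 1) = p + 2 * e + 3 * r + 2 by omega,
    show r + (p + 1) = r + p + 1 by ring]
  generalize hm1 : p + 2 * e + 2 * r + 2 = m1
  generalize hm2 : p + 2 * e + 3 * r + 2 = m2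
  have hm1' : (m1 : ℝ) = p + 2 * e + 2 * r + 2 := by rw [← hm1]; push_cast; ring
  have hm2' : (m2 : ℝ) = p + 2 * e + 3 * r + 2 := by rw [← hm2]; push_cast; ring
  simp only [Nat.factorial_succ]
  push_cast
  have hpos : ∀ n : ℕ, (n.factorial : ℝ) ≠ 0 := fun n => by exact_mod_cast n.factorial_ne_zero
  have h1 := hpos m1
  have h2 := hpos m2
  have d1 : (p : ℝ) + 1 + e + r - p ≠ 0 := by
    rw [show (p : ℝ) + 1 + e + r - p = e + r + 1 by ring]; positivity
  have d2 : 2 * ((p : ℝ) + 1 + e + r - p) + 1 ≠ 0 := by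
    rw [show (p : ℝ) + 1 + e + r - p = e + r + 1 by ring]; positivity
  have d3 : 2 * ((p : ℝ) + 1 + e + r - (p + 1)) + 1 ≠ 0 := by
    rw [show (p : ℝ) + 1 + e + r - (p + 1) = e + r by ring]; positivity
  have d4 : (m1 : ℝ) + 1 ≠ 0 := by positivity
  have d5 : (m2 : ℝ) + 1 ≠ 0 := by positivity
  generalize (m1.factorial : ℝ) = f1 at *
  generalize (m2.factorial : ℝ) = f2 at *
  generalize (p.factorial : ℝ) = f3 at *
  generalize ((r + p).factorial : ℝ) = f4 at *
  generalize (e.factorial : ℝ) = f5 at *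
  generalize ((e + r).factorial : ℝ) = f6 at *
  generalize ((e + 2 * r).factorial : ℝ) = f7 at *
  have s1 : (p : ℝ) + 1 + e + r - p = e + r + 1 := by ring
  have s3 : (p : ℝ) + 1 + e + r - (p + 1) = e + r := by ring
  rw [s1] at d1 d2 ⊢
  rw [s3] at d3 ⊢
  rw [hm1'] at d4 ⊢
  rw [hm2'] at d5 ⊢
  clear hm1' hm2'
  rw [div_mul_div_comm, div_mul_div_comm, div_eq_div_iff (by simp [*]) (by simp [*])]
  ring

/-! ### The recurrence as intertwining relations of matrices -/

open Matrix

/-- The tridiagonal matrix of the recurrence. -/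
def jacobiMat (d r : ℕ) : Matrix (Fin (d + 1)) (Fin (d + 1)) ℝ :=
  Matrix.of fun p k =>
    (if (k : ℕ) = p + 1 then upCoeff d r (p : ℕ) else 0) +
    (if (k : ℕ) = p then (casimirSum d r - casimir d r (p : ℕ)) / 2 else 0) +
    (if (k : ℕ) + 1 = p then downCoeff d r (p : ℕ) else 0)

/-- The matrix of the values of `racahPoly`. -/
def racahMat (d r : ℕ) : Matrix (Fin (d + 1)) (Fin (d + 1)) ℝ :=
  Matrix.of fun p q => racahPoly d r (p : ℕ) (q : ℕ)

/-- The diagonal matrix of the weights. -/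
def weightMat (d r : ℕ) : Matrix (Fin (d + 1)) (Fin (d + 1)) ℝ :=
  Matrix.diagonal fun p => racahWeight d r p

/-- The diagonal matrix of the Casimir eigenvalues. -/
def casimirMat (d r : ℕ) : Matrix (Fin (d + 1)) (Fin (d + 1)) ℝ :=
  Matrix.diagonal fun p => casimir d r (p : ℕ)

/-- The diagonal matrix with entries `(-1)^p`. -/
def signMat (d : ℕ) : Matrix (Fin (d + 1)) (Fin (d + 1)) ℝ :=
  Matrix.diagonal fun p => (-1) ^ (p : ℕ)

theorem sum_ite_val_eq {n : ℕ} (g : Fin n → ℝ) (m : ℕ) :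
    ∑ k : Fin n, (if (k : ℕ) = m then g k else 0) = if h : m < n then g ⟨m, h⟩ else 0 := by
  split_ifs with h
  · rw [Finset.sum_eq_single ⟨m, h⟩]
    · simp
    · intro b _ hb
      rw [if_neg]
      intro h'
      exact hb (Fin.ext h')
    · simp
  · refine Finset.sum_eq_zero fun k _ => ?_
    rw [if_neg]
    omega

theorem sum_jacobiMat_mul (d r : ℕ) (p : Fin (d + 1)) (g : Fin (d + 1) → ℝ) :
    ∑ k, jacobiMat d r p k * g k =
      (if h : (p : ℕ) + 1 < d + 1 then upCoeff d r (p : ℕ) * g ⟨p + 1, h⟩ else 0) +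
      (casimirSum d r - casimir d r (p : ℕ)) / 2 * g p +
      (if h : 0 < (p : ℕ) then downCoeff d r (p : ℕ) * g ⟨p - 1, by omega⟩ else 0) := by
  simp only [jacobiMat, Matrix.of_apply, add_mul, ite_mul, zero_mul, Finset.sum_add_distrib]
  rw [sum_ite_val_eq (fun k => upCoeff d r (p : ℕ) * g k),
    sum_ite_val_eq (fun k => (casimirSum d r - casimir d r (p : ℕ)) / 2 * g k)]
  congr 1
  · rw [dif_pos p.isLt]
  · split_ifs with h
    · have : ∀ k : Fin (d + 1), (k : ℕ) + 1 = p ↔ (k : ℕ) = p - 1 := fun k => by omega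
      simp only [this]
      rw [sum_ite_val_eq (fun k => downCoeff d r (p : ℕ) * g k), dif_pos]
    · refine Finset.sum_eq_zero fun k _ => ?_
      rw [if_neg]
      omega

theorem racahMat_transpose (d r : ℕ) : (racahMat d r)ᵀ = racahMat d r := by
  ext p q
  exact racahPoly_comm _ _ _ _

theorem jacobiMat_mul_racahMat (d r : ℕ) :
    jacobiMat d r * racahMat d r = racahMat d r * casimirMat d r := by
  ext p q
  rw [casimirMat, Matrix.mul_diagonal, Matrix.mul_apply, sum_jacobiMat_mul]
  have hp : (p : ℕ) ≤ d := by omega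
  have hq : ((q : ℕ) : ℤ) ≤ d := by omega
  have h := racahPoly_recurrence (r := r) hp hq
  simp only [racahMat, Matrix.of_apply]
  rw [mul_comm, Int.cast_natCast] at h
  rw [mul_comm _ (casimir _ _ _), ← h, mul_comm (upCoeff _ _ _)]
  congr 1
  · congr 1
    split_ifs with h1
    · push_cast
      ring
    · rw [racahPoly_of_lt (by omega), zero_mul]
  · split_ifs with h1
    · push_cast [Nat.cast_sub (by omega : 1 ≤ (p : ℕ))]
      ring
    · rw [racahPoly_neg (by omega), mul_zero]

theorem racahMat_mul_jacobiMat_transpose (d r : ℕ) :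
    racahMat d r * (jacobiMat d r)ᵀ = casimirMat d r * racahMat d r := by
  have h := congrArg Matrix.transpose (jacobiMat_mul_racahMat d r)
  rwa [Matrix.transpose_mul, Matrix.transpose_mul, racahMat_transpose, casimirMat,
    Matrix.diagonal_transpose] at h

theorem weightMat_mul_jacobiMat (d r : ℕ) :
    weightMat d r * jacobiMat d r = (jacobiMat d r)ᵀ * weightMat d r := by
  ext p q
  rw [weightMat, Matrix.diagonal_mul, Matrix.mul_diagonal, Matrix.transpose_apply, jacobiMat,
    Matrix.of_apply, Matrix.of_apply]
  rcases lt_trichotomy (p : ℕ) q with h | h | h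
  · rcases eq_or_ne (q : ℕ) (p + 1) with h' | h'
    · have := racahWeight_balance (r := r) (by omega : (p : ℕ) < d)
      have h2 : ¬ (p : ℕ) + 1 + 1 = p := by omega
      have h3 : ¬ (p : ℕ) = p + 1 + 1 := by omega
      simpa [h', h2, h3] using this
    · rw [if_neg h', if_neg (by omega), if_neg (by omega), if_neg (by omega), if_neg (by omega),
        if_neg (by omega)]
      simp
  · obtain rfl := Fin.ext h
    ring
  · rcases eq_or_ne (p : ℕ) (q + 1) with h' | h'
    · have := racahWeight_balance (r := r) (by omega : (q : ℕ) < d)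
      have h2 : ¬ (q : ℕ) + 1 + 1 = q := by omega
      have h3 : ¬ (q : ℕ) = q + 1 + 1 := by omega
      simp only [h', h2, h3, Nat.cast_add, Nat.cast_one, if_true, if_false, add_zero, zero_add,
        left_eq_add, one_ne_zero, add_eq_left]
      linarith
    · rw [if_neg (by omega), if_neg (by omega), if_neg (by omega), if_neg h', if_neg (by omega),
        if_neg (by omega)]
      simp

theorem signMat_mul_self (d : ℕ) : signMat d * signMat d = 1 := by
  simp [signMat, Matrix.diagonal_mul_diagonal, ← mul_pow]

/-- Conjugation by the sign matrix is the permutation of the three Casimir operators. -/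
theorem signMat_mul_jacobiMat (d r : ℕ) :
    signMat d * jacobiMat d r =
      (casimirSum d r • 1 - casimirMat d r - jacobiMat d r) * signMat d := by
  ext p q
  rw [signMat, Matrix.diagonal_mul, Matrix.mul_diagonal, Matrix.sub_apply, Matrix.sub_apply,
    Matrix.smul_apply, casimirMat, jacobiMat, Matrix.of_apply]
  -- On the diagonal, `jacobiMat` is exactly half of `casimirSum - casimir`; off it, only
  -- neighbouring indices occur, and their signs are opposite.
  rcases eq_or_ne p q with rfl | hne
  · simp
    ring
  · have hne' : (p : ℕ) ≠ q := fun h => hne (Fin.ext h)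
    rw [Matrix.one_apply_ne hne, Matrix.diagonal_apply_ne _ hne, if_neg hne'.symm]
    rcases eq_or_ne (q : ℕ) (p + 1) with h | h
    · rw [if_pos h, if_neg (by omega), h, pow_succ]
      simp
      ring
    · rcases eq_or_ne ((q : ℕ) + 1) p with h' | h'
      · rw [if_neg h, if_pos h', ← h', pow_succ]
        simp
        ring
      · rw [if_neg h, if_neg h']
        simp

/-! ### Uniqueness of intertwiners up to a scalar -/

/-- Row n of the relation expresses row n + 1 of Z through the two rows before it, because `upCoeff`
is nonzero below d. -/
theorem eq_zero_of_first_row {d r : ℕ} {Z : Matrix (Fin (d + 1)) (Fin (d + 1)) ℝ}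
    (hZ : jacobiMat d r * Z = Z * (jacobiMat d r)ᵀ) (h0 : ∀ q, Z 0 q = 0) : Z = 0 := by
  have key : ∀ n (p : Fin (d + 1)), (p : ℕ) ≤ n → ∀ q, Z p q = 0 := by
    intro n
    induction n with
    | zero =>
      intro p hp q
      rw [show p = 0 from Fin.ext (by simpa using hp), h0]
    | succ n ih =>
      intro p hp q
      rcases Nat.lt_or_ge n p with hlt | hle
      · have hn : n < d + 1 := by omega
        have e := congrFun (congrFun hZ ⟨n, hn⟩) q
        rw [Matrix.mul_apply, sum_jacobiMat_mul, Matrix.mul_apply,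
          Finset.sum_eq_zero (fun k _ => by rw [ih _ le_rfl, zero_mul]),
          dif_pos (by simp; omega)] at e
        simp only [ih ⟨n, hn⟩ le_rfl, mul_zero, add_zero] at e
        have h1 : (if h : 0 < n then
            downCoeff d r n * Z ⟨n - 1, by omega⟩ q else 0) = 0 := by
          split_ifs
          · rw [ih _ (by simp), mul_zero]
          · rfl
        rw [h1, add_zero] at e
        rcases mul_eq_zero.1 e with h | h
        · exact absurd h (upCoeff_pos (by omega)).ne'
        · rwa [show p = ⟨n + 1, by omega⟩ from Fin.ext (by simp; omega)]
      · exact ih p hle q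
  ext p q
  exact key p p le_rfl q

theorem casimir_injective {d r p q : ℕ} (hp : p ≤ d) (hq : q ≤ d)
    (h : casimir d r p = casimir d r q) : p = q := by
  have hp' : (p : ℝ) ≤ d := by exact_mod_cast hp
  have hq' : (q : ℝ) ≤ d := by exact_mod_cast hq
  have hr : (0 : ℝ) ≤ r := by positivity
  have h' : ((q : ℝ) - p) * (2 * d + 2 * r - p - q + 1) = 0 := by
    unfold casimir at h
    linear_combination h
  rcases mul_eq_zero.1 h' with h | h
  · have : (q : ℝ) = p := by linarith
    exact_mod_cast this.symm
  · linarith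

/-- The Casimir eigenvalues are distinct, so the first row of Z is supported at its first entry. -/
theorem eq_zero_of_commute {d r : ℕ} {Z : Matrix (Fin (d + 1)) (Fin (d + 1)) ℝ}
    (hU : jacobiMat d r * Z = Z * (jacobiMat d r)ᵀ)
    (hL : casimirMat d r * Z = Z * casimirMat d r) (h0 : Z 0 0 = 0) : Z = 0 := by
  refine eq_zero_of_first_row hU fun q => ?_
  rcases eq_or_ne q 0 with rfl | hq
  · exact h0
  · have e := congrFun (congrFun hL 0) q
    rw [casimirMat, Matrix.diagonal_mul, Matrix.mul_diagonal, mul_comm, mul_eq_mul_left_iff] at e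
    rcases e with e | e
    · have := casimir_injective (by simp) (by omega) e
      exact absurd (Fin.ext this.symm) hq
    · exact e

/-- The first row of `hL` is a three-term relation along the columns. It is solved downwards from
the last column, since `downCoeff` is nonzero. -/
theorem eq_zero_of_anticommute {d r : ℕ} {Z : Matrix (Fin (d + 1)) (Fin (d + 1)) ℝ}
    (hU : jacobiMat d r * Z = Z * (jacobiMat d r)ᵀ)
    (hL : casimirMat d r * Z = Z * (casimirSum d r • 1 - casimirMat d r - (jacobiMat d r)ᵀ))
    (h0 : Z 0 (Fin.last d) = 0) : Z = 0 := by
  have key : ∀ n (q : Fin (d + 1)), d ≤ q + n → Z 0 q = 0 := by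
    intro n
    induction n with
    | zero =>
      intro q hq
      rwa [show q = Fin.last d from Fin.ext (by simp; omega)]
    | succ n ih =>
      intro q hq
      rcases Nat.lt_or_ge (q + n) d with hlt | hle
      · have hn : (q : ℕ) + 1 < d + 1 := by omega
        have z1 : Z 0 ⟨q + 1, hn⟩ = 0 := ih _ (by simp; omega)
        have e := congrFun (congrFun hL 0) ⟨q + 1, hn⟩
        have e2 : (Z * (jacobiMat d r)ᵀ) 0 ⟨q + 1, hn⟩ = 0 := by
          rw [Matrix.mul_sub, Matrix.mul_sub, Matrix.sub_apply, Matrix.sub_apply, casimirMat,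
            Matrix.diagonal_mul, Matrix.mul_diagonal, Matrix.mul_smul, Matrix.smul_apply, mul_one,
            z1] at e
          simpa using e
        rw [Matrix.mul_apply] at e2
        simp only [Matrix.transpose_apply, mul_comm (Z _ _)] at e2
        rw [sum_jacobiMat_mul, z1, dif_pos (by simp : 0 < (q : ℕ) + 1)] at e2
        have h1 : (if h : (q : ℕ) + 1 + 1 < d + 1 then
            upCoeff d r ((q + 1 : ℕ) : ℝ) * Z 0 ⟨q + 1 + 1, h⟩ else 0) = 0 := by
          split_ifs
          · rw [ih _ (by simp; omega), mul_zero]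
          · rfl
        simp only [h1, mul_zero, zero_add] at e2
        rcases mul_eq_zero.1 e2 with h | h
        · exact absurd h (downCoeff_pos (by omega)).ne'
        · exact h
      · exact ih q hle
  exact eq_zero_of_first_row hU fun q => key d q (by omega)

/-! ### The corner entry that fixes the scalar -/

/-- Zeilberger's method with X fixed: the sums satisfy (d+1)(X-d) S(d+1) = S(d), and G in the proof
is the antidifference that shows it. -/
theorem sum_factorial_mul_invFact (X d : ℕ) (hd : d ≤ X) :
    ∑ p ∈ Finset.range (d + 1), (2 * (X : ℝ) - 2 * p + 1) * ((2 * X - d - p).factorial : ℝ) *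
        (invFact (2 * X + 1 - p) * invFact (d - p) * invFact p) =
      ((X - d).factorial : ℝ) / (d.factorial * X.factorial) := by
  induction d with
  | zero =>
    have e : invFact (2 * X + 1) = (((2 * X + 1).factorial : ℕ) : ℝ)⁻¹ :=
      invFact_of_eq (by push_cast; ring)
    have := Nat.factorial_ne_zero X
    have := Nat.factorial_ne_zero (2 * X)
    have e0 : invFact 0 = 1 := by simp [invFact]
    simp [e, e0, Nat.factorial_succ]
    field_simp
  | succ d ih =>
    have ih := ih (by omega)
    let G : ℕ → ℝ := fun p => ((p : ℝ) - 1 - X) * ((2 * X - d - p).factorial : ℝ) *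
      (invFact (2 * X + 1 - p) * invFact (d + 1 - p) * invFact (p - 1))
    have hG : ∀ p ∈ Finset.range (d + 2),
        ((d : ℝ) + 1) * (X - d) * ((2 * (X : ℝ) - 2 * p + 1) *
          ((2 * X - (d + 1) - p).factorial : ℝ) *
          (invFact (2 * X + 1 - p) * invFact ((d + 1 : ℕ) - p) * invFact p)) -
        (2 * (X : ℝ) - 2 * p + 1) * ((2 * X - d - p).factorial : ℝ) *
          (invFact (2 * X + 1 - p) * invFact (d - p) * invFact p) = G (p + 1) - G p := by
      intro p hp
      have hp : p ≤ d + 1 := by simpa [Nat.lt_succ_iff] using hp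
      have hf : ((2 * X - d - p).factorial : ℝ) =
          (2 * X - d - p) * ((2 * X - (d + 1) - p).factorial : ℝ) := by
        rw [show 2 * X - d - p = (2 * X - (d + 1) - p) + 1 by omega, Nat.factorial_succ]
        push_cast [Nat.cast_sub (by omega : p ≤ 2 * X - (d + 1)),
          Nat.cast_sub (by omega : d + 1 ≤ 2 * X)]
        ring
      have hf' : 2 * X - d - (p + 1) = 2 * X - (d + 1) - p := by omega
      simp only [G, hf', hf]
      have e1 : invFact (d - p) = (d + 1 - p) * invFact (d + 1 - p) :=
        invFact_eq_mul (by ring) (by push_cast; ring)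
      have e2 : invFact (2 * X + 1 - (p + 1)) = (2 * X + 1 - p) * invFact (2 * X + 1 - p) :=
        invFact_eq_mul (by ring) (by push_cast; ring)
      have e3 : invFact ((p : ℤ) - 1) = p * invFact p :=
        invFact_eq_mul (by ring) (by push_cast; ring)
      push_cast
      rw [show (d : ℤ) + 1 - (p + 1) = d - p by ring, show (p : ℤ) + 1 - 1 = p by ring,
        e1, e2, e3]
      ring
    have hs := Finset.sum_congr rfl hG
    have hG0 : G 0 = 0 := by
      simp [G, invFact_of_neg (by omega : (-1 : ℤ) < 0)]
    have hG1 : G (d + 2) = 0 := by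
      simp only [G]
      rw [invFact_of_neg (by push_cast; omega : (d : ℤ) + 1 - ((d + 2 : ℕ) : ℤ) < 0)]
      simp
    rw [Finset.sum_sub_distrib, ← Finset.mul_sum, Finset.sum_range_sub, hG0, hG1,
      Finset.sum_range_succ (fun p : ℕ => (2 * (X : ℝ) - 2 * p + 1) *
        ((2 * X - d - p).factorial : ℝ) *
        (invFact (2 * X + 1 - p) * invFact (d - p) * invFact p)), ih,
      invFact_of_neg (by push_cast; omega : (d : ℤ) - ((d + 1 : ℕ) : ℤ) < 0)] at hs
    have hXd : ((X - d).factorial : ℝ) = (X - d) * ((X - (d + 1)).factorial : ℝ) := by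
      rw [show X - d = (X - (d + 1)) + 1 by omega, Nat.factorial_succ]
      push_cast [Nat.cast_sub hd]
      ring
    have hpos : (0 : ℝ) < X - d := by
      have : ((d + 1 : ℕ) : ℝ) ≤ X := by exact_mod_cast hd
      push_cast at this
      linarith
    have h1 := Nat.factorial_ne_zero X
    have h2 := Nat.factorial_ne_zero d
    have h3 : (0 : ℝ) < (d : ℝ) + 1 := by positivity
    rw [hXd] at hs
    rw [Nat.factorial_succ]
    push_cast at hs ⊢
    have h4 : ((d : ℝ) + 1) * (X - d) ≠ 0 := by positivity
    refine mul_left_cancel₀ h4 ?_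
    rw [mul_zero, zero_mul, mul_zero, add_zero, sub_zero] at hs
    rw [sub_eq_zero.1 hs]
    field_simp

/-- In the extreme row, as in the extreme column of `racahPoly_last_right`, the inverse factorials
leave a single term of the sum. -/
theorem racahPoly_zero_left {d r p : ℕ} (hp : p ≤ d) :
    racahPoly d r 0 p = ((2 * d + 3 * r + 1).factorial : ℝ) *
      ((p.factorial : ℝ) * r.factorial * (r + p).factorial * (d - p).factorial *
        (d + r - p).factorial)⁻¹ := by
  rw [racahPoly, Finset.sum_eq_single 0]
  · rw [racahTerm, invFact_of_eq (n := 0) (by simp), invFact_of_eq (n := p) (by simp),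
      invFact_of_eq (n := r) (by simp), invFact_of_eq (n := r + p) (by simp),
      invFact_of_eq (n := 0) (by simp), invFact_of_eq (n := d - p) (by push_cast [hp]; ring),
      invFact_of_eq (n := d + r - p) (by push_cast [show p ≤ d + r by omega]; ring)]
    simp
    exact Or.inl (by ring)
  · intro i _ hi
    rw [racahTerm, invFact_of_neg (by omega : (0 : ℤ) - i < 0)]
    simp
  · simp

theorem racahPoly_last_right {d r p : ℕ} (hp : p ≤ d) :
    racahPoly d r p d = (-1) ^ p * ((2 * d + 3 * r + 1 - p).factorial : ℝ) *
      ((p.factorial : ℝ) * r.factorial ^ 2 * (d - p).factorial * (d + r - p).factorial)⁻¹ := by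
  rw [racahPoly, Finset.sum_eq_single p]
  · rw [racahTerm, invFact_of_eq (n := 0) (by simp),
      invFact_of_eq (n := d - p) (by push_cast [hp]; ring),
      invFact_of_eq (n := r) (by ring),
      invFact_of_eq (n := d + r - p) (by push_cast [show p ≤ d + r by omega]; ring),
      invFact_natCast, invFact_of_eq (n := 0) (by ring),
      invFact_of_eq (n := r) (by ring)]
    simp
    exact Or.inl (by ring)
  · intro i _ hi
    rcases Nat.lt_or_gt_of_ne hi with h | h
    · rw [racahTerm, invFact_of_neg (by omega : (d : ℤ) - p - d + i < 0)]
      simp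
    · rw [racahTerm, invFact_of_neg (by omega : (p : ℤ) - i < 0)]
      simp
  · intro h
    exact absurd (Finset.mem_range.2 (by omega)) h

/-- This is the (0, d) entry of RDHR, where both Racah factors are single products. -/
theorem sum_racahPoly_zero_last (d r : ℕ) :
    ∑ p ∈ Finset.range (d + 1), racahPoly d r 0 p * (-1) ^ p * racahWeight d r p *
      racahPoly d r p d = racahPoly d r 0 d := by
  have hT : ∀ p ∈ Finset.range (d + 1), racahPoly d r 0 p * (-1) ^ p * racahWeight d r p *
      racahPoly d r p d = (((2 * d + 3 * r + 1).factorial : ℝ) * (((r.factorial : ℝ)) ^ 3)⁻¹) *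
      ((2 * ((d + r : ℕ) : ℝ) - 2 * p + 1) * ((2 * (d + r) - d - p).factorial : ℝ) *
        (invFact (2 * (d + r : ℕ) + 1 - p) * invFact (d - p) * invFact p)) := by
    intro p hp
    have hp : p ≤ d := by simpa [Nat.lt_succ_iff] using hp
    rw [racahPoly_zero_left hp, racahPoly_last_right hp, racahWeight,
      invFact_of_eq (n := 2 * (d + r) + 1 - p) (by omega),
      invFact_of_eq (n := d - p) (by omega), invFact_natCast,
      show 2 * (d + r) - d - p = d + 2 * r - p by omega]
    have hpos : ∀ n : ℕ, (n.factorial : ℝ) ≠ 0 := fun n => by exact_mod_cast n.factorial_ne_zero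
    have f1 := hpos p
    have f2 := hpos (r + p)
    have f3 := hpos (d - p)
    have f4 := hpos (d + r - p)
    have f5 := hpos (2 * d + 3 * r + 1 - p)
    have f6 := hpos (2 * (d + r) + 1 - p)
    have f7 := hpos r
    have hs : ((-1 : ℝ) ^ p) * (-1) ^ p = 1 := by rw [← mul_pow]; simp
    push_cast
    field_simp
    linear_combination (2 * ((d : ℝ) + r - p) + 1) * hs
  rw [Finset.sum_congr rfl hT, ← Finset.mul_sum, sum_factorial_mul_invFact (d + r) d (by omega),
    racahPoly_zero_left le_rfl]
  have hpos : ∀ n : ℕ, (n.factorial : ℝ) ≠ 0 := fun n => by exact_mod_cast n.factorial_ne_zero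
  have f1 := hpos d
  have f2 := hpos (d + r)
  have f3 := hpos r
  rw [Nat.add_sub_cancel_left, add_comm r d, Nat.sub_self]
  simp
  field_simp

/-! ### The braid relation and the involution property -/

/-- R exchanges two of the Casimirs U, L, C - L - U, passing to transposes, and fixes the third; D
exchanges another pair. Both words realise the same permutation, as in the braid relation of the
symmetric group on three letters. -/
theorem racah_intertwine_braid {M : Type*} [Ring M] {R D H U V L C : M}
    (hC : ∀ x, C * x = x * C) (hUR : U * R = R * L) (hRV : R * V = L * R) (hHU : H * U = V * H)
    (hUD : U * D = D * (C - L - U)) (hDV : D * V = (C - L - V) * D)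
    (hVD : V * D = D * (C - L - V)) (hDL : D * L = L * D) (hHL : H * L = L * H) :
    U * (R * D * H * R) = R * D * H * R * V ∧
    L * (R * D * H * R) = R * D * H * R * (C - L - V) ∧
    U * (D * R * D) = D * R * D * V ∧
    L * (D * R * D) = D * R * D * (C - L - V) := by
  have hR : (C - L - U) * R = R * (C - L - V) := by
    rw [sub_mul, sub_mul, hC, ← hRV, hUR, mul_sub, mul_sub, sub_right_comm]
  refine ⟨?_, ?_, ?_, ?_⟩
  · calc U * (R * D * H * R) = (U * R) * D * H * R := by simp only [mul_assoc]
      _ = R * (D * L) * H * R := by rw [hUR, hDL]; simp only [mul_assoc]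
      _ = R * D * H * (L * R) := by rw [← mul_assoc (R * D * H), mul_assoc (R * D) H, hHL]
                                    simp only [mul_assoc]
      _ = _ := by rw [← hRV]; simp only [mul_assoc]
  · calc L * (R * D * H * R) = (L * R) * D * H * R := by simp only [mul_assoc]
      _ = R * (V * D) * H * R := by rw [← hRV]; simp only [mul_assoc]
      _ = R * D * ((C - L - V) * H) * R := by rw [hVD]; simp only [mul_assoc]
      _ = R * D * H * ((C - L - U) * R) := by
        rw [sub_mul, sub_mul, hC, ← hHL, ← hHU, ← mul_sub, ← mul_sub]; simp only [mul_assoc]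
      _ = R * D * H * (R * (C - L - V)) := by rw [hR]
      _ = _ := by simp only [mul_assoc]
  · calc U * (D * R * D) = (U * D) * R * D := by simp only [mul_assoc]
      _ = D * ((C - L - U) * R) * D := by rw [hUD]; simp only [mul_assoc]
      _ = D * (R * (C - L - V)) * D := by rw [hR]
      _ = D * R * ((C - L - V) * D) := by simp only [mul_assoc]
      _ = _ := by rw [← hDV]; simp only [mul_assoc]
  · calc L * (D * R * D) = (L * D) * R * D := by simp only [mul_assoc]
      _ = D * (L * R) * D := by rw [← hDL]; simp only [mul_assoc]
      _ = D * R * (V * D) := by rw [← hRV]; simp only [mul_assoc]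
      _ = _ := by rw [hVD]; simp only [mul_assoc]

theorem jacobiMat_mul_signMat (d r : ℕ) :
    jacobiMat d r * signMat d =
      signMat d * (casimirSum d r • 1 - casimirMat d r - jacobiMat d r) := by
  have h := congrArg (fun Z => signMat d * Z * signMat d) (signMat_mul_jacobiMat d r)
  simp only [mul_assoc, signMat_mul_self, mul_one] at h
  rwa [← mul_assoc, signMat_mul_self, one_mul] at h

theorem signMat_transpose (d : ℕ) : (signMat d)ᵀ = signMat d := by
  rw [signMat, Matrix.diagonal_transpose]

theorem casimirMat_transpose (d r : ℕ) : (casimirMat d r)ᵀ = casimirMat d r := by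
  rw [casimirMat, Matrix.diagonal_transpose]

theorem racahMat_braid_aux (d r : ℕ) :
    racahMat d r * signMat d * weightMat d r * racahMat d r =
      ((-1 : ℝ) ^ d) • (signMat d * racahMat d r * signMat d) := by
  obtain ⟨h1, h2, h3, h4⟩ := racah_intertwine_braid (C := casimirSum d r • 1)
    (by intro x; simp) (jacobiMat_mul_racahMat d r) (racahMat_mul_jacobiMat_transpose d r)
    (weightMat_mul_jacobiMat d r) (jacobiMat_mul_signMat d r)
    (by
      have h := congrArg Matrix.transpose (jacobiMat_mul_signMat d r)
      simpa [Matrix.transpose_mul, signMat_transpose, casimirMat_transpose] using h)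
    (by
      have h := congrArg Matrix.transpose (signMat_mul_jacobiMat d r)
      simpa [Matrix.transpose_mul, signMat_transpose, casimirMat_transpose] using h)
    (by simp [signMat, casimirMat, Matrix.diagonal_mul_diagonal, mul_comm])
    (by simp [weightMat, casimirMat, Matrix.diagonal_mul_diagonal, mul_comm])
  rw [← sub_eq_zero]
  apply eq_zero_of_anticommute (d := d) (r := r)
  · rw [mul_sub, sub_mul, h1, mul_smul_comm, h3, smul_mul_assoc]
  · rw [mul_sub, sub_mul, h2, mul_smul_comm, h4, smul_mul_assoc]
  · have e1 : (racahMat d r * signMat d * weightMat d r * racahMat d r) 0 (Fin.last d) =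
        racahPoly d r 0 d := by
      rw [← sum_racahPoly_zero_last, Finset.sum_range, Matrix.mul_apply]
      refine Finset.sum_congr rfl fun p _ => ?_
      rw [weightMat, Matrix.mul_diagonal, signMat, Matrix.mul_diagonal]
      simp [racahMat]
    have hs : ((-1 : ℝ) ^ d) * (-1) ^ d = 1 := by rw [← mul_pow]; simp
    rw [Matrix.sub_apply, e1, Matrix.smul_apply, signMat, Matrix.mul_diagonal,
      Matrix.diagonal_mul]
    simp [racahMat]
    linear_combination (-racahPoly d r 0 d) * hs

/-- Both sides intertwine U with its transpose and commute with L, so `eq_zero_of_commute` applies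
once the (0, 0) entries are matched. The value of g is found later from the braid relation. -/
theorem exists_racahMat_mul_weightMat_mul_racahMat (d r : ℕ) :
    ∃ g : ℝ, racahMat d r * weightMat d r * racahMat d r =
      g • Matrix.diagonal fun p : Fin (d + 1) => (racahWeight d r p)⁻¹ := by
  set R := racahMat d r with hR
  set H := weightMat d r with hH
  set U := jacobiMat d r with hU
  set L := casimirMat d r with hL
  have hw : ∀ p : Fin (d + 1), racahWeight d r p ≠ 0 := fun p =>
    (racahWeight_pos (by omega)).ne'
  let K : Matrix (Fin (d + 1)) (Fin (d + 1)) ℝ := Matrix.diagonal fun p => (racahWeight d r p)⁻¹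
  have hHK : H * K = 1 := by
    simp [hH, K, weightMat, Matrix.diagonal_mul_diagonal, hw]
  have hKH : K * H = 1 := by
    simp [hH, K, weightMat, Matrix.diagonal_mul_diagonal, hw]
  have hHL : H * L = L * H := by
    simp [hH, hL, weightMat, casimirMat, Matrix.diagonal_mul_diagonal, mul_comm]
  have hKL : L * K = K * L := by
    simp [K, hL, casimirMat, Matrix.diagonal_mul_diagonal, mul_comm]
  have hUR : U * R = R * L := jacobiMat_mul_racahMat d r
  have hRV : R * Uᵀ = L * R := racahMat_mul_jacobiMat_transpose d r
  have hHU : H * U = Uᵀ * H := weightMat_mul_jacobiMat d r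
  have hUK : U * K = K * Uᵀ := by
    calc U * K = K * (H * U) * K := by rw [← mul_assoc, hKH, one_mul]
      _ = K * Uᵀ * (H * K) := by rw [hHU]; simp only [mul_assoc]
      _ = _ := by rw [hHK, mul_one]
  refine ⟨(R * H * R) 0 0 * racahWeight d r 0, ?_⟩
  rw [← sub_eq_zero]
  apply eq_zero_of_commute (d := d) (r := r)
  · rw [mul_sub, sub_mul, mul_smul_comm, smul_mul_assoc]
    change _ - _ • (U * K) = _ - _ • (K * Uᵀ)
    rw [hUK]
    congr 1
    calc U * (R * H * R) = (U * R) * H * R := by simp only [mul_assoc]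
      _ = R * (H * L) * R := by rw [hUR, hHL]; simp only [mul_assoc]
      _ = R * H * (L * R) := by simp only [mul_assoc]
      _ = R * H * R * Uᵀ := by rw [← hRV]; simp only [mul_assoc]
  · rw [mul_sub, sub_mul, mul_smul_comm, smul_mul_assoc]
    change _ - _ • (L * K) = _ - _ • (K * L)
    rw [hKL]
    congr 1
    calc L * (R * H * R) = (L * R) * H * R := by simp only [mul_assoc]
      _ = R * (Uᵀ * H) * R := by rw [← hRV]; simp only [mul_assoc]
      _ = R * H * (U * R) := by rw [← hHU]; simp only [mul_assoc]
      _ = R * H * R * L := by rw [hUR]; simp only [mul_assoc]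
  · have := hw 0
    simp at this
    simp
    field_simp
    ring

/-- The normalised Racah matrix. -/
def racahOrtho (d r : ℕ) : Matrix (Fin (d + 1)) (Fin (d + 1)) ℝ :=
  Matrix.of fun p q => √(racahWeight d r p) * √(racahWeight d r q) * racahPoly d r (p : ℕ) (q : ℕ)

theorem racahOrtho_eq (d r : ℕ) :
    racahOrtho d r = (Matrix.diagonal fun p : Fin (d + 1) => √(racahWeight d r p)) *
      racahMat d r * (Matrix.diagonal fun p : Fin (d + 1) => √(racahWeight d r p)) := by
  ext p q
  rw [Matrix.mul_diagonal, Matrix.diagonal_mul, racahOrtho, racahMat, Matrix.of_apply,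
    Matrix.of_apply]
  ring

theorem racahOrtho_mul_signMat_mul_racahOrtho (d r : ℕ) :
    racahOrtho d r * signMat d * racahOrtho d r =
      ((-1 : ℝ) ^ d) • (signMat d * racahOrtho d r * signMat d) := by
  rw [racahOrtho_eq]
  set S : Matrix (Fin (d + 1)) (Fin (d + 1)) ℝ :=
    Matrix.diagonal fun p : Fin (d + 1) => √(racahWeight d r p) with hS
  have hSS : S * S = weightMat d r := by
    rw [hS, Matrix.diagonal_mul_diagonal, weightMat]
    congr 1
    funext p
    exact Real.mul_self_sqrt (racahWeight_pos (by omega)).le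
  have hSD : S * signMat d = signMat d * S := by
    simp [hS, signMat, Matrix.diagonal_mul_diagonal, mul_comm]
  calc S * racahMat d r * S * signMat d * (S * racahMat d r * S)
      = S * racahMat d r * (S * signMat d) * S * racahMat d r * S := by simp only [mul_assoc]
    _ = S * (racahMat d r * signMat d * (S * S) * racahMat d r) * S := by
      rw [hSD]; simp only [mul_assoc]
    _ = ((-1 : ℝ) ^ d) • ((S * signMat d) * racahMat d r * (signMat d * S)) := by
      rw [hSS, racahMat_braid_aux, mul_smul_comm, smul_mul_assoc]; simp only [mul_assoc]
    _ = _ := by rw [← hSD, hSD]; simp only [mul_assoc]; rw [hSD]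

theorem racahPoly_zero_zero_pos (d r : ℕ) : 0 < racahPoly d r 0 0 := by
  have := racahPoly_zero_left (r := r) (Nat.zero_le d)
  rw [Nat.cast_zero] at this
  rw [this]
  have := fun n => Nat.factorial_pos n
  positivity

theorem racahOrtho_mul_self (d r : ℕ) : racahOrtho d r * racahOrtho d r = 1 := by
  set A := racahOrtho d r with hA
  set D := signMat d with hD
  obtain ⟨g, hg⟩ : ∃ g : ℝ, A * A = g • 1 := by
    obtain ⟨g, hg⟩ := exists_racahMat_mul_weightMat_mul_racahMat d r
    refine ⟨g, ?_⟩
    rw [hA, racahOrtho_eq]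
    set S : Matrix (Fin (d + 1)) (Fin (d + 1)) ℝ :=
      Matrix.diagonal fun p : Fin (d + 1) => √(racahWeight d r p) with hS
    have hSS : S * S = weightMat d r := by
      rw [hS, Matrix.diagonal_mul_diagonal, weightMat]
      congr 1
      funext p
      exact Real.mul_self_sqrt (racahWeight_pos (by omega)).le
    calc S * racahMat d r * S * (S * racahMat d r * S)
        = S * (racahMat d r * (S * S) * racahMat d r) * S := by simp only [mul_assoc]
      _ = g • 1 := by
        rw [hSS, hg, mul_smul_comm, smul_mul_assoc, hS, Matrix.diagonal_mul_diagonal,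
          Matrix.diagonal_mul_diagonal]
        congr 1
        rw [← Matrix.diagonal_one]
        congr 1
        funext p
        have h := racahWeight_pos (r := r) (by omega : (p : ℕ) ≤ d)
        have h' := Real.mul_self_sqrt h.le
        rw [mul_right_comm, h', mul_inv_cancel₀ h.ne']
  have hDD : D * D = 1 := signMat_mul_self d
  have hbr := racahOrtho_mul_signMat_mul_racahOrtho d r
  rw [← hA, ← hD] at hbr
  have hs : ((-1 : ℝ) ^ d) * (-1) ^ d = 1 := by rw [← mul_pow]; simp
  -- The square of ADA is g²; by the braid relation it is also the square of DAD, which is g.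
  have hgg : (g * g) • (1 : Matrix (Fin (d + 1)) (Fin (d + 1)) ℝ) = g • 1 := by
    calc (g * g) • (1 : Matrix (Fin (d + 1)) (Fin (d + 1)) ℝ)
        = A * D * (A * A) * D * A := by
          rw [hg]
          simp only [mul_smul_comm, smul_mul_assoc, mul_one]
          rw [mul_assoc A D D, hDD, mul_one, hg, smul_smul]
      _ = (A * D * A) * (A * D * A) := by simp only [mul_assoc]
      _ = (D * A * D) * (D * A * D) := by
          rw [hbr, smul_mul_smul_comm, hs, one_smul]
      _ = D * A * (D * D) * A * D := by simp only [mul_assoc]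
      _ = D * (A * A) * D := by rw [hDD, mul_one]; simp only [mul_assoc]
      _ = g • 1 := by rw [hg, mul_smul_comm, smul_mul_assoc, mul_one, hDD]
  have hgg' : g * g = g := by simpa using congrFun (congrFun hgg 0) 0
  have hg0 : 0 < g := by
    have h0 := congrFun (congrFun hg 0) 0
    rw [Matrix.mul_apply] at h0
    -- By symmetry of A the entry (A²)₀₀ = g is a sum of squares, and A₀₀ > 0.
    have hsymm : ∀ k, A 0 k * A k 0 = A 0 k ^ 2 := by
      intro k
      simp only [hA, racahOrtho, Matrix.of_apply]
      rw [racahPoly_comm d r ((k : ℕ) : ℤ)]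
      ring
    simp only [hsymm] at h0
    have h1 : 0 < A 0 0 := by
      have h2 := Real.sqrt_pos.2 (racahWeight_pos (r := r) (Nat.zero_le d))
      have h3 := racahPoly_zero_zero_pos d r
      simp only [hA, racahOrtho, Matrix.of_apply]
      simp
      positivity
    have h2 := Finset.single_le_sum (f := fun k => A 0 k ^ 2) (fun k _ => sq_nonneg (A 0 k))
      (Finset.mem_univ 0)
    simp only [h0] at h2
    simp at h2
    nlinarith
  have : g = 1 := by
    have : g * (g - 1) = 0 := by linear_combination hgg'
    rcases mul_eq_zero.1 this with h | h
    · exact absurd h hg0.ne'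
    · linarith
  rw [hg, this, one_smul]

/-! ### The relations deduced from two involutions -/

theorem PermProjRelations.map {M M' : Type*} [Ring M] [Algebra ℝ M] [Ring M'] [Algebra ℝ M']
    {S S' Q Q' : M} {ξ η : ℝ} (h : PermProjRelations S S' Q Q' ξ η) (φ : M →ₐ[ℝ] M') :
    PermProjRelations (φ S) (φ S') (φ Q) (φ Q') ξ η where
  proj_sq := by rw [← map_mul, h.proj_sq]
  perm_sq := by rw [← map_mul, h.perm_sq, map_one]
  proj_perm := by rw [← map_mul, h.proj_perm, map_smul]
  perm_proj := by rw [← map_mul, h.perm_proj, map_smul]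
  braid := by simp only [← map_mul, h.braid]
  proj_perm_perm := by simp only [← map_mul, h.proj_perm_perm]
  perm_proj_perm := by simp only [← map_mul, h.perm_proj_perm]
  proj_perm_proj := by simp only [← map_mul, h.proj_perm_proj, map_smul]
  proj_proj_proj := by simp only [← map_mul, h.proj_proj_proj, map_smul]
  proj_proj_perm := by simp only [← map_mul, h.proj_proj_perm, map_smul]
  perm_proj_proj := by simp only [← map_mul, h.perm_proj_proj, map_smul]

/-- Conjugation by an involution. -/
def conjInvolution {M : Type*} [Ring M] [Algebra ℝ M] {A : M} (hA : A * A = 1) : M →ₐ[ℝ] M where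
  toFun x := A * x * A
  map_one' := by rw [mul_one, hA]
  map_mul' x y := by
    calc A * (x * y) * A = A * x * 1 * y * A := by rw [mul_one, mul_assoc A x y]
      _ = A * x * A * (A * y * A) := by rw [← hA]; simp only [mul_assoc]
  map_zero' := by simp
  map_add' x y := by rw [mul_add, add_mul]
  commutes' c := by rw [← Algebra.commutes, mul_assoc, hA, mul_one]

theorem PermProjRelations.of_involutions {M : Type*} [Ring M] [Algebra ℝ M] {A D P : M}
    {ε ξ a : ℝ} (hA : A * A = 1) (hD : D * D = 1) (hADA : A * D * A = ε • (D * A * D))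
    (hε : ε * ε = 1) (hξ : ξ * ξ = 1) (hP : P * P = P) (hPD : P * D = ξ • P)
    (hDP : D * P = ξ • P) (hPAP : P * A * P = a • P) :
    PermProjRelations D (A * D * A) P (A * P * A) ξ (ε * a) where
  proj_sq := hP
  perm_sq := hD
  proj_perm := hPD
  perm_proj := hDP
  braid := by
    calc D * (A * D * A) * D = ε • ((D * D) * A * (D * D)) := by
          rw [hADA, mul_smul_comm, smul_mul_assoc]; simp only [mul_assoc]
      -- Inserting ADDA = 1 creates a factor DAD, which `hADA` turns back into ADA; the next
      -- relation uses the same device.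
      _ = ε • (D * (A * (D * D) * A) * D * A) := by
          simp only [hD, mul_one, one_mul, hA]
      _ = ε • ((D * A * D) * (D * (A * D * A))) := by simp only [mul_assoc]
      _ = _ := by rw [← smul_mul_assoc, ← hADA]; simp only [mul_assoc]
  proj_perm_perm := by
    calc P * (A * D * A) * D = ε • ((P * D) * A * (D * D)) := by
          rw [hADA, mul_smul_comm, smul_mul_assoc]; simp only [mul_assoc]
      _ = ε • ((D * P) * A) := by rw [hD, hPD, hDP, mul_one]
      _ = ε • (D * (A * (D * D) * A) * P * A) := by rw [hD, mul_one, hA, mul_one]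
      _ = ε • ((D * A * D) * (D * (A * P * A))) := by simp only [mul_assoc]
      _ = _ := by rw [← smul_mul_assoc, ← hADA]; simp only [mul_assoc]
  perm_proj_perm := by
    calc D * (A * P * A) * D = (ξ * ξ) • (D * A * P * A * D) := by
          rw [hξ, one_smul]; simp only [mul_assoc]
      _ = D * A * ((D * P) * D) * A * D := by
          rw [hDP, smul_mul_assoc, hPD]
          simp only [smul_smul, mul_smul_comm, smul_mul_assoc]
      _ = (ε * ε) • ((D * A * D) * P * (D * A * D)) := by
          rw [hε, one_smul]; simp only [mul_assoc]
      _ = _ := by rw [hADA]; simp only [smul_smul, mul_smul_comm, smul_mul_assoc]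
  proj_perm_proj := by
    calc P * (A * D * A) * P = ε • ((P * D) * A * (D * P)) := by
          rw [hADA, mul_smul_comm, smul_mul_assoc]; simp only [mul_assoc]
      _ = (ε * (ξ * ξ)) • (P * A * P) := by
          rw [hPD, hDP]; simp only [smul_smul, mul_smul_comm, smul_mul_assoc, mul_assoc]
      _ = _ := by rw [hξ, mul_one, hPAP, smul_smul]
  proj_proj_proj := by
    calc P * (A * P * A) * P = (P * A * P) * A * P := by simp only [mul_assoc]
      _ = (ε * ε * (a * a)) • P := by
          rw [hPAP, smul_mul_assoc, smul_mul_assoc, hPAP, smul_smul, hε, one_mul]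
      _ = _ := by congr 1; ring
  proj_proj_perm := by
    calc P * (A * P * A) * D = (P * A * P) * A * D := by simp only [mul_assoc]
      _ = a • (P * A * D) := by rw [hPAP, smul_mul_assoc, smul_mul_assoc]
      _ = (ξ * (ε * a)) • (ε • ((P * D) * A * D)) := by
          rw [hPD, smul_mul_assoc, smul_mul_assoc, smul_smul, smul_smul]
          congr 1
          linear_combination (-a * ε * ε) * hξ - a * hε
      _ = _ := by rw [hADA, mul_smul_comm]; simp only [mul_assoc]
  perm_proj_proj := by
    calc D * (A * P * A) * P = D * A * (P * A * P) := by simp only [mul_assoc]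
      _ = a • (D * A * P) := by rw [hPAP, mul_smul_comm]
      _ = (ξ * (ε * a)) • (ε • (D * A * (D * P))) := by
          rw [hDP, mul_smul_comm, smul_smul, smul_smul]
          congr 1
          linear_combination (-a * ε * ε) * hξ - a * hε
      _ = _ := by rw [hADA, smul_mul_assoc]; simp only [mul_assoc]

/-! ### Identification of the 6-j symbols with Racah polynomials -/

theorem triangleCoeff_eq {a b c x y z w : ℕ} (hx : (a + b - c) / 2 = x) (hy : (a + c - b) / 2 = y)
    (hz : (b + c - a) / 2 = z) (hw : (a + b + c) / 2 + 1 = w) :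
    triangleCoeff a b c = √((x.factorial * y.factorial * z.factorial : ℝ) / w.factorial) := by
  rw [triangleCoeff, hx, hy, hz, hw]

/-- In the two ranges of n the individual triangle coefficients differ, but their product is the
same function of d, r and p: an instance of Regge symmetry. -/
theorem sqrt_mul_triangleCoeff_mul {N n d r k₀ p : ℕ} (hN : N = d + r + k₀)
    (hn : n = d + 3 * k₀) (hk : k₀ = 0 ∨ k₀ = r) (hp : p ≤ d) :
    √(2 * (N : ℝ) - 2 * ((k₀ + p : ℕ) : ℝ) + 1) *
      (triangleCoeff N N (2 * N - 2 * (k₀ + p)) *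
        triangleCoeff N (3 * N - 2 * n) (2 * N - 2 * (k₀ + p))) = √(racahWeight d r p) := by
  have hj : (0 : ℝ) ≤ 2 * (N : ℝ) - 2 * ((k₀ + p : ℕ) : ℝ) + 1 := by
    have : k₀ + p ≤ N := by omega
    have : ((k₀ + p : ℕ) : ℝ) ≤ N := by exact_mod_cast this
    linarith
  have hjj : 2 * (N : ℝ) - 2 * ((k₀ + p : ℕ) : ℝ) + 1 = 2 * (d + r - p) + 1 := by
    rw [hN]; push_cast; ring
  rcases hk with rfl | rfl
  · rw [triangleCoeff_eq (a := N) (b := N) (x := p) (y := d + r - p) (z := d + r - p)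
        (w := 2 * (d + r) + 1 - p) (by omega) (by omega) (by omega) (by omega),
      triangleCoeff_eq (a := N) (b := 3 * N - 2 * n) (x := r + p) (y := d - p)
        (z := d + 2 * r - p)
        (w := 2 * d + 3 * r + 1 - p) (by omega) (by omega) (by omega) (by omega),
      ← Real.sqrt_mul (by positivity), ← Real.sqrt_mul hj, hjj, racahWeight]
    congr 1
    have := Nat.factorial_ne_zero (2 * (d + r) + 1 - p)
    have := Nat.factorial_ne_zero (2 * d + 3 * r + 1 - p)
    field_simp
  · rw [triangleCoeff_eq (a := N) (b := N) (x := k₀ + p) (y := d + k₀ - p) (z := d + k₀ - p)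
        (w := 2 * d + 3 * k₀ + 1 - p) (by omega) (by omega) (by omega) (by omega),
      triangleCoeff_eq (a := N) (b := 3 * N - 2 * n) (x := p) (y := d + 2 * k₀ - p)
        (z := d - p)
        (w := 2 * (d + k₀) + 1 - p) (by omega) (by omega) (by omega) (by omega),
      ← Real.sqrt_mul (by positivity), ← Real.sqrt_mul hj, hjj, racahWeight]
    congr 1
    have := Nat.factorial_ne_zero (2 * (d + k₀) + 1 - p)
    have := Nat.factorial_ne_zero (2 * d + 3 * k₀ + 1 - p)
    field_simp

theorem sum_eq_racahPoly {d r p q : ℕ} (hp : p ≤ d) (hq : q ≤ d) (s : Finset ℕ)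
    (hs : ∀ t, t ∈ s ↔ 2 * d + 3 * r - p ≤ t ∧ 2 * d + 3 * r - q ≤ t ∧ t ≤ 2 * d + 3 * r ∧
      t ≤ 3 * d + 3 * r - p - q) :
    ∑ t ∈ s, (-1 : ℝ) ^ t * ((t + 1).factorial : ℝ) /
      (((t - (2 * d + 2 * r - p)).factorial : ℝ) * ((t - (2 * d + 3 * r - q)).factorial : ℝ) *
        ((t - (2 * d + 2 * r - q)).factorial : ℝ) * ((t - (2 * d + 3 * r - p)).factorial : ℝ) *
        ((2 * d + 3 * r - t).factorial : ℝ) * ((3 * d + 4 * r - p - q - t).factorial : ℝ) *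
        ((3 * d + 3 * r - p - q - t).factorial : ℝ)) =
      (-1) ^ r * racahPoly d r p q := by
  have hsub : racahPoly d r p q =
      ∑ i ∈ (Finset.range (d + 1)).filter (fun i => i ≤ p ∧ i ≤ q ∧ p + q ≤ d + i),
        racahTerm d r p q i := by
    rw [racahPoly]
    refine (Finset.sum_filter_of_ne fun i _ hi => ?_).symm
    by_contra hcon
    apply hi
    rw [racahTerm]
    by_cases h1 : i ≤ p
    · by_cases h2 : i ≤ q
      · rw [invFact_of_neg (by omega : (d : ℤ) - p - q + i < 0)]
        simp
      · rw [invFact_of_neg (by omega : (q : ℤ) - i < 0)]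
        simp
    · rw [invFact_of_neg (by omega : (p : ℤ) - i < 0)]
      simp
  rw [hsub, Finset.mul_sum]
  -- The substitution t = 2d + 3r - i; the parity of 3r produces the sign (-1)^r.
  refine Finset.sum_nbij' (fun t => 2 * d + 3 * r - t) (fun i => 2 * d + 3 * r - i) ?_ ?_ ?_ ?_ ?_
  · intro t ht
    rw [hs] at ht
    simp only [Finset.mem_filter, Finset.mem_range]
    omega
  · intro i hi
    simp only [Finset.mem_filter, Finset.mem_range] at hi
    rw [hs]
    omega
  · intro t ht
    rw [hs] at ht
    omega
  · intro i hi
    simp only [Finset.mem_filter, Finset.mem_range] at hi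
    omega
  · intro t ht
    rw [hs] at ht
    obtain ⟨i, hi⟩ : ∃ i, 2 * d + 3 * r - t = i := ⟨_, rfl⟩
    have hsign : (-1 : ℝ) ^ t = (-1) ^ r * (-1) ^ i := by
      rw [← pow_add]
      exact neg_one_pow_congr (by rw [Nat.even_iff, Nat.even_iff]; omega)
    rw [hi, hsign, racahTerm,
      invFact_of_eq (n := t - (2 * d + 3 * r - p)) (by omega : (p : ℤ) - i = _),
      invFact_of_eq (n := t - (2 * d + 3 * r - q)) (by omega : (q : ℤ) - i = _),
      invFact_of_eq (n := t - (2 * d + 2 * r - p)) (by omega : (r : ℤ) + p - i = _),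
      invFact_of_eq (n := t - (2 * d + 2 * r - q)) (by omega : (r : ℤ) + q - i = _),
      invFact_of_eq (n := i) rfl,
      invFact_of_eq (n := 3 * d + 3 * r - p - q - t) (by omega : (d : ℤ) - p - q + i = _),
      invFact_of_eq (n := 3 * d + 4 * r - p - q - t) (by omega : (d : ℤ) + r - p - q + i = _),
      show 2 * d + 3 * r + 1 - i = t + 1 by omega, div_eq_mul_inv]
    simp only [mul_inv]
    ring

theorem racahSum_eq {N n d r k₀ p q : ℕ} (hN : N = d + r + k₀) (hn : n = d + 3 * k₀)
    (hk : k₀ = 0 ∨ k₀ = r) (hp : p ≤ d) (hq : q ≤ d) :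
    racahSum N N (2 * N - 2 * (k₀ + p)) N (3 * N - 2 * n) (2 * N - 2 * (k₀ + q)) =
      (-1) ^ r * racahPoly d r p q := by
  rw [racahSum]
  rcases hk with rfl | rfl
  · rw [show (N + N + (2 * N - 2 * (0 + p))) / 2 = 2 * d + 2 * r - p by omega,
      show (N + (3 * N - 2 * n) + (2 * N - 2 * (0 + q))) / 2 = 2 * d + 3 * r - q by omega,
      show (N + N + (2 * N - 2 * (0 + q))) / 2 = 2 * d + 2 * r - q by omega,
      show (N + (3 * N - 2 * n) + (2 * N - 2 * (0 + p))) / 2 = 2 * d + 3 * r - p by omega,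
      show (N + N + N + (3 * N - 2 * n)) / 2 = 2 * d + 3 * r by omega,
      show (N + (2 * N - 2 * (0 + p)) + (3 * N - 2 * n) + (2 * N - 2 * (0 + q))) / 2 =
        3 * d + 4 * r - p - q by omega,
      show (N + (2 * N - 2 * (0 + p)) + N + (2 * N - 2 * (0 + q))) / 2 =
        3 * d + 3 * r - p - q by omega]
    refine sum_eq_racahPoly hp hq _ fun t => ?_
    simp only [Finset.mem_Icc, max_le_iff, le_min_iff]
    omega
  · rw [show (N + N + (2 * N - 2 * (k₀ + p))) / 2 = 2 * d + 3 * k₀ - p by omega,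
      show (N + (3 * N - 2 * n) + (2 * N - 2 * (k₀ + q))) / 2 = 2 * d + 2 * k₀ - q by omega,
      show (N + N + (2 * N - 2 * (k₀ + q))) / 2 = 2 * d + 3 * k₀ - q by omega,
      show (N + (3 * N - 2 * n) + (2 * N - 2 * (k₀ + p))) / 2 = 2 * d + 2 * k₀ - p by omega,
      show (N + N + N + (3 * N - 2 * n)) / 2 = 2 * d + 3 * k₀ by omega,
      show (N + (2 * N - 2 * (k₀ + p)) + (3 * N - 2 * n) + (2 * N - 2 * (k₀ + q))) / 2 =
        3 * d + 3 * k₀ - p - q by omega,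
      show (N + (2 * N - 2 * (k₀ + p)) + N + (2 * N - 2 * (k₀ + q))) / 2 =
        3 * d + 4 * k₀ - p - q by omega]
    -- The second range of n only permutes the factorials in Racah's denominator, so the same sum
    -- appears.
    rw [← sum_eq_racahPoly hp hq (Finset.Icc
      (max (max (2 * d + 3 * k₀ - p) (2 * d + 2 * k₀ - q))
        (max (2 * d + 3 * k₀ - q) (2 * d + 2 * k₀ - p)))
      (min (min (2 * d + 3 * k₀) (3 * d + 3 * k₀ - p - q)) (3 * d + 4 * k₀ - p - q)))]
    · refine Finset.sum_congr rfl fun t _ => ?_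
      congr 1
      ring
    · intro t
      simp only [Finset.mem_Icc, max_le_iff, le_min_iff]
      omega

theorem mem_levelRange {N n d r k₀ : ℕ} (hN : N = d + r + k₀) (hn : n = d + 3 * k₀)
    (hk : k₀ = 0 ∨ k₀ = r) (k : ℕ) : k ∈ levelRange N n ↔ k₀ ≤ k ∧ k ≤ k₀ + d := by
  unfold levelRange
  split_ifs <;> rw [Finset.mem_Icc] <;> omega

theorem matA_apply {N n d r k₀ p q : ℕ} (hN : N = d + r + k₀) (hn : n = d + 3 * k₀)
    (hk : k₀ = 0 ∨ k₀ = r) (hp : p ≤ d) (hq : q ≤ d) {k k' : levelRange N n}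
    (hkp : (k : ℕ) = k₀ + p) (hkq : (k' : ℕ) = k₀ + q) :
    matA N n k k' = √(racahWeight d r p) * √(racahWeight d r q) * racahPoly d r p q := by
  have hT : SpinTriad N N (2 * N - 2 * (k₀ + p)) ∧
      SpinTriad N (3 * N - 2 * n) (2 * N - 2 * (k₀ + q)) ∧
      SpinTriad N N (2 * N - 2 * (k₀ + q)) ∧
      SpinTriad N (3 * N - 2 * n) (2 * N - 2 * (k₀ + p)) := by
    simp only [SpinTriad, Nat.even_iff]
    omega
  -- The exponent N - n equals r or -r, so the prefactor of A cancels the sign of the reindexed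
  -- Racah sum.
  have hsign : (-1 : ℝ) ^ ((N : ℤ) - n) * (-1) ^ r = 1 := by
    have hr : ((-1 : ℝ) ^ r) * (-1) ^ r = 1 := by rw [← mul_pow]; simp
    rcases hk with h | h
    · rw [show (N : ℤ) - n = r by omega, zpow_natCast, hr]
    · rw [show (N : ℤ) - n = -r by omega, _root_.zpow_neg, zpow_natCast, inv_mul_cancel₀]
      exact pow_ne_zero _ (by norm_num)
  have hj : (0 : ℝ) ≤ 2 * (N : ℝ) - 2 * ((k₀ + p : ℕ) : ℝ) + 1 := by
    have : k₀ + p ≤ N := by omega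
    have : ((k₀ + p : ℕ) : ℝ) ≤ N := by exact_mod_cast this
    linarith
  rw [matA, Matrix.of_apply, hkp, hkq, sixJ, if_pos hT, racahSum_eq hN hn hk hp hq,
    Real.sqrt_mul hj, ← sqrt_mul_triangleCoeff_mul hN hn hk hp,
    ← sqrt_mul_triangleCoeff_mul hN hn hk hq]
  linear_combination (√(2 * (N : ℝ) - 2 * ((k₀ + p : ℕ) : ℝ) + 1) *
      (triangleCoeff N N (2 * N - 2 * (k₀ + p)) *
        triangleCoeff N (3 * N - 2 * n) (2 * N - 2 * (k₀ + p))) *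
      (√(2 * (N : ℝ) - 2 * ((k₀ + q : ℕ) : ℝ) + 1) *
      (triangleCoeff N N (2 * N - 2 * (k₀ + q)) *
        triangleCoeff N (3 * N - 2 * n) (2 * N - 2 * (k₀ + q)))) * racahPoly d r p q) * hsign

theorem matA_mul_self_and_braid {N n : ℕ} (hn : 2 * n ≤ 3 * N) :
    matA N n * matA N n = 1 ∧
      matA N n * matD N n * matA N n =
        ((-1 : ℝ) ^ n) • (matD N n * matA N n * matD N n) := by
  obtain ⟨d, r, k₀, hN, hn', hk⟩ :
      ∃ d r k₀, N = d + r + k₀ ∧ n = d + 3 * k₀ ∧ (k₀ = 0 ∨ k₀ = r) := by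
    rcases le_total n N with h | h
    -- Here k₀ is the least index of the range, d + 1 its length, and r = |N - n|.
    · exact ⟨n, N - n, 0, by omega, by omega, Or.inl rfl⟩
    · exact ⟨3 * N - 2 * n, n - N, n - N, by omega, by omega, Or.inr rfl⟩
  have hmem := mem_levelRange hN hn' hk
  let e : levelRange N n ≃ Fin (d + 1) :=
    { toFun := fun k => ⟨k - k₀, by have := (hmem k).1 k.2; omega⟩
      invFun := fun p => ⟨k₀ + p, (hmem _).2 (by omega)⟩
      left_inv := fun k => Subtype.ext (by have := (hmem k).1 k.2; simp; omega)
      right_inv := fun p => Fin.ext (by simp) }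
  have hek : ∀ k : levelRange N n, (k : ℕ) = k₀ + (e k : ℕ) := fun k => by
    have := (hmem k).1 k.2
    simp only [e, Equiv.coe_fn_mk]
    omega
  have hA : matA N n = (racahOrtho d r).submatrix e e := by
    ext k k'
    exact matA_apply hN hn' hk (by omega) (by omega) (hek k) (hek k')
  have hD : matD N n = ((-1 : ℝ) ^ k₀) • (signMat d).submatrix e e := by
    ext k k'
    rw [matD, Matrix.smul_apply, Matrix.submatrix_apply, signMat]
    rcases eq_or_ne k k' with rfl | hne
    · rw [Matrix.diagonal_apply_eq, Matrix.diagonal_apply_eq, hek k, pow_add, smul_eq_mul]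
    · rw [Matrix.diagonal_apply_ne _ hne, Matrix.diagonal_apply_ne _ (e.injective.ne hne),
        smul_zero]
  constructor
  · rw [hA, Matrix.submatrix_mul_equiv, racahOrtho_mul_self, Matrix.submatrix_one_equiv]
  · have h := congrArg (fun Z => Z.submatrix e e) (racahOrtho_mul_signMat_mul_racahOrtho d r)
    simp only [Matrix.submatrix_smul, Pi.smul_apply, ← Matrix.submatrix_mul_equiv _ _ _ e] at h
    rw [← hA] at h
    rw [hD]
    simp only [mul_smul_comm, smul_mul_assoc, h, smul_smul]
    congr 1
    rw [← pow_add, ← pow_add, ← pow_add]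
    -- Each D carries (-1)^k₀, so the total sign is governed by d + k₀, which has the parity of n =
    -- d + 3k₀.
    exact neg_one_pow_congr (by rw [Nat.even_iff, Nat.even_iff]; omega)

/-! ### The matrix unit and the conclusion -/

theorem matPi_mul_mul_matPi (N n : ℕ) (m : levelRange N n)
    (B : Matrix (levelRange N n) (levelRange N n) ℝ) :
    matPi N n m * B * matPi N n m = B m m • matPi N n m := by
  have h : matPi N n m = Matrix.single m m 1 := by
    ext k k'
    simp [matPi, Matrix.single, eq_comm]
  rw [h, Matrix.single_mul_mul_single, Matrix.smul_single]
  simp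

theorem matD_mul_matPi (N n : ℕ) (m : levelRange N n) :
    matD N n * matPi N n m = ((-1 : ℝ) ^ (m : ℕ)) • matPi N n m := by
  ext k k'
  rw [matD, Matrix.diagonal_mul, Matrix.smul_apply, matPi, Matrix.of_apply]
  split_ifs with h
  · rw [h.1, smul_eq_mul]
  · simp

theorem matPi_mul_matD (N n : ℕ) (m : levelRange N n) :
    matPi N n m * matD N n = ((-1 : ℝ) ^ (m : ℕ)) • matPi N n m := by
  ext k k'
  rw [matD, Matrix.mul_diagonal, Matrix.smul_apply, matPi, Matrix.of_apply]
  split_ifs with h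
  · rw [h.2, smul_eq_mul, mul_comm]
  · simp

end

theorem lemma4 (N : ℕ) (hN : 0 < N) (n : ℕ) (hn : 2 * n ≤ 3 * N) (m : levelRange N n) :
    PermProjRelations (matD N n) (matDhat N n) (matPi N n m) (matPihat N n m)
        ((-1 : ℝ) ^ (m : ℕ)) ((-1 : ℝ) ^ n * matA N n m m) ∧
      PermProjRelations (matDhat N n) (matD N n) (matPihat N n m) (matPi N n m)
        ((-1 : ℝ) ^ (m : ℕ)) ((-1 : ℝ) ^ n * matA N n m m) := by
  obtain ⟨hA, hbraid⟩ := matA_mul_self_and_braid hn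
  have hsq : ∀ l : ℕ, ((-1 : ℝ) ^ l) * (-1) ^ l = 1 := fun l => by rw [← mul_pow]; simp
  have hD : matD N n * matD N n = 1 := by
    rw [matD, Matrix.diagonal_mul_diagonal, ← Matrix.diagonal_one]
    exact congrArg _ (funext fun k => hsq k)
  have hP : matPi N n m * matPi N n m = matPi N n m := by
    simpa using matPi_mul_mul_matPi N n m 1
  have h1 : PermProjRelations (matD N n) (matDhat N n) (matPi N n m) (matPihat N n m)
      ((-1 : ℝ) ^ (m : ℕ)) ((-1 : ℝ) ^ n * matA N n m m) :=
    PermProjRelations.of_involutions hA hD hbraid (hsq n) (hsq m) hP (matPi_mul_matD N n m)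
      (matD_mul_matPi N n m) (matPi_mul_mul_matPi N n m _)
  have hconj : ∀ Z : Matrix (levelRange N n) (levelRange N n) ℝ,
      matA N n * (matA N n * Z * matA N n) * matA N n = Z := fun Z => by
    calc matA N n * (matA N n * Z * matA N n) * matA N n
        = (matA N n * matA N n) * Z * (matA N n * matA N n) := by simp only [mul_assoc]
      _ = Z := by rw [hA, one_mul, mul_one]
  -- Since A² = 1, conjugation by A is an algebra map taking each matrix to its hatted partner and
  -- back.
  have h2 := h1.map (conjInvolution hA)
  change PermProjRelations (matDhat N n) (matA N n * matDhat N n * matA N n) (matPihat N n m)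
    (matA N n * matPihat N n m * matA N n) _ _ at h2
  rw [matDhat, matPihat, hconj, hconj] at h2
  exact ⟨h1, h2⟩
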